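/- **Setting.** Let $d\ge 1$, $n\ge 0$, $\mathbb R_+=[0,\infty)$, $\boldsymbol\alpha\in\mathbb R_+^n$, and let $\boldsymbol s$ be an $n\times d$ matrix with entries in $\mathbb R_+$ and rows $\boldsymbol s_1,\dots,\boldsymbol s_n$. The gamma convolution $\mathcal G_{d,n}(\boldsymbol\alpha,\boldsymbol s)$ is the law on $\mathbb R_+^d$ with cumulant generating function $K(\boldsymbol t)=-\sum_{i=1}^n\alpha_i\ln(1-\langle\boldsymbol s_i,\boldsymbol t\rangle)$, i.e. the law of $\boldsymbol s^{\top}\boldsymbol Z$ where $Z_1,\dots,Z_n$ are independent gamma variables with shapes $\alpha_i$ and unit scale ($Z_i=0$ if $\alpha_i=0$). Write $f_{\boldsymbol\alpha,\boldsymbol s}$ for its Lebesgue density when it has one. With $h(z)=\frac{z+1}{z-1}$ and $h(1)=\infty$, the parameters $(\boldsymbol\alpha,\boldsymbol s)$ are *$\epsilon$-well-behaved* if $\sum_i\alpha_i>1$ and, for every $I\subseteq\{1,\dots,n\}$ with $\sum_{i\in I}\alpha_i>\sum_{i\notin I}\alpha_i$, every solution $\boldsymbol t\in\mathbb C^d$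 of the system $\langle \boldsymbol s_i,\boldsymbol t\rangle=1$ $(i\in I)$ satisfies $|h(t_j)|>1+\epsilon$ for at least one $j$. They are *well-behaved* if they are $\epsilon$-well-behaved for some $\epsilon>0$. For $\boldsymbol k\in\mathbb N^d$ and $\boldsymbol x\in\mathbb R_+^d$ let $\phi_{\boldsymbol k}(\boldsymbol x)=\prod_{i=1}^d\phi_{k_i}(x_i)$, where $\phi_k(x)=\sqrt2\,e^{-x}\sum_{\ell=0}^k\binom k\ell\frac{(-2x)^\ell}{\ell!}$. Let $a_{\boldsymbol k}(\boldsymbol\alpha,\boldsymbol s)=\mathbb E\,\phi_{\boldsymbol k}(\boldsymbol Y)$ for $\boldsymbol Y\sim\mathcal G_{d,n}(\boldsymbol\alpha,\boldsymbol s)$ (which equals $\int f_{\boldsymbol\alpha,\boldsymbol s}\,\phi_{\boldsymbol k}$ when there is a density). For observations $\boldsymbol X_1,\dots,\boldsymbol X_N$ and $\boldsymbol m\in\mathbb N^d$ let $$\hat a_{\boldsymbol k}=\frac1N\sum_{i=1}^N\phi_{\boldsymbol k}(\boldsymbol X_i),\qquad L_{\boldsymbol m,N}(\boldsymbol\alpha,\boldsymbol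 s)=\sum_{\boldsymbol k\le\boldsymbol m}\bigl(\hat a_{\boldsymbol k}-a_{\boldsymbol k}(\boldsymbol\alpha,\boldsymbol s)\bigr)^2 ,$$ where $\boldsymbol k\le\boldsymbol m$ is meant componentwise. **Property (Consistency).** Let $(\boldsymbol\alpha_0,\boldsymbol s_0)$ be well-behaved and suppose that $\mathcal G_{d,n}(\boldsymbol\alpha_0,\boldsymbol s_0)$ has a density $f=f_{\boldsymbol\alpha_0,\boldsymbol s_0}\in L_2(\mathbb R_+^d)$. Let $\boldsymbol X_1,\boldsymbol X_2,\dots$ be i.i.d. with density $f$. For each $\boldsymbol m$ and $N$ let $(\hat{\boldsymbol\alpha},\hat{\boldsymbol s})$ be any global minimizer of $L_{\boldsymbol m,N}$ over all well-behaved $(\boldsymbol\alpha,\boldsymbol s)\in\mathbb R_+^n\times\mathbb R_+^{n\times d}$, whenever one exists. Then almost surely $\lVert f-f_{\hat{\boldsymbol\alpha},\hat{\boldsymbol s}}\rVert_2^2\to0$ as $N\to\infty$ and then $\boldsymbol m\to\infty$, uniformly over the choice of minimizer. Precisely, almost surely, for every $\varepsilon>0$ there is $\boldsymbol m_0$ such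 that for every $\boldsymbol m\ge\boldsymbol m_0$ there is $N_0$ such that for every $N\ge N_0$ and every global minimizer $(\hat{\boldsymbol\alpha},\hat{\boldsymbol s})$ of $L_{\boldsymbol m,N}$, the law $\mathcal G_{d,n}(\hat{\boldsymbol\alpha},\hat{\boldsymbol s})$ has a density and $\lVert f-f_{\hat{\boldsymbol\alpha},\hat{\boldsymbol s}}\rVert_2^2<\varepsilon$. -/

import Mathlib

open MeasureTheory ProbabilityTheory Filter
open scoped NNReal ENNReal

noncomputable section

/-- The gamma law with shape `a ≥ 0` and unit scale; the law of shape `0` is the Dirac mass at `0`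
(its moment generating function is `(1 - t) ^ (-0) = 1`). -/
def stdGamma (a : ℝ≥0) : Measure ℝ :=
  if a = 0 then Measure.dirac 0 else gammaMeasure a 1

instance stdGamma_isProbabilityMeasure (a : ℝ≥0) : IsProbabilityMeasure (stdGamma a) := by
  unfold stdGamma
  split_ifs with h
  · infer_instance
  · exact isProbabilityMeasure_gammaMeasure (by positivity) one_pos

/-- The linear map `z ↦ sᵀ z`, i.e. `z ↦ ∑ i, z i • s i`. -/
def mixScales {d n : ℕ} (s : Matrix (Fin n) (Fin d) ℝ≥0) (z : Fin n → ℝ) : Fin d → ℝ :=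
  fun j => ∑ i, (s i j : ℝ) * z i

/-- The multivariate gamma convolution `𝒢_{d,n}(α, s)`: the law on `ℝ^d` of `sᵀ Z`, where
`Z 1, …, Z n` are independent gamma variables of shapes `α 1, …, α n` and unit scale. It has
cumulant generating function `K(t) = -∑ i, α i * log (1 - ⟨s i, t⟩)`, see `cgf_gammaConv`. -/
def gammaConv {d n : ℕ} (α : Fin n → ℝ≥0) (s : Matrix (Fin n) (Fin d) ℝ≥0) :
    Measure (Fin d → ℝ) :=
  (Measure.pi fun i => stdGamma (α i)).map (mixScales s)

/-- The density `f_{α,s}` with respect to Lebesgue measure of the gamma convolution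
(it is the density as soon as `gammaConv α s ≪ volume`). -/
def gammaConvDensity {d n : ℕ} (α : Fin n → ℝ≥0) (s : Matrix (Fin n) (Fin d) ℝ≥0)
    (x : Fin d → ℝ) : ℝ :=
  ((gammaConv α s).rnDeriv volume x).toReal

/-- `ε`-well-behaved parameters. With the Möbius transform `h(z) = (z + 1) / (z - 1)`,
`h(1) = ∞`, the inequality `(1 + ε) * ‖t j - 1‖ < ‖t j + 1‖` says that `|h(t j)| > 1 + ε`. -/
def EpsWellBehaved {d n : ℕ} (ε : ℝ) (α : Fin n → ℝ≥0) (s : Matrix (Fin n) (Fin d) ℝ≥0) : Prop :=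
  1 < ∑ i, α i ∧
    ∀ I : Finset (Fin n), ∑ i ∈ Iᶜ, α i < ∑ i ∈ I, α i →
      ∀ t : Fin d → ℂ, (∀ i ∈ I, ∑ j, ((s i j : ℝ) : ℂ) * t j = 1) →
        ∃ j, (1 + ε) * ‖t j - 1‖ < ‖t j + 1‖

/-- Well-behaved parameters. -/
def WellBehaved {d n : ℕ} (α : Fin n → ℝ≥0) (s : Matrix (Fin n) (Fin d) ℝ≥0) : Prop :=
  ∃ ε : ℝ, 0 < ε ∧ EpsWellBehaved ε α s

/-- The univariate Laguerre function on `[0, ∞)`, extended by `0`. -/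
def laguerreFun (k : ℕ) (x : ℝ) : ℝ :=
  if 0 ≤ x then
    √2 * Real.exp (-x) *
      ∑ l ∈ Finset.range (k + 1), (k.choose l : ℝ) * ((-2 * x) ^ l / (l.factorial : ℝ))
  else 0

/-- The tensorized Laguerre function `φ_k`, supported in `[0, ∞)^d`. -/
def laguerre {d : ℕ} (k : Fin d → ℕ) (x : Fin d → ℝ) : ℝ :=
  ∏ j, laguerreFun (k j) (x j)

/-- The Laguerre coefficient `a_k(α, s) = ∫ φ_k f_{α,s}` of the gamma convolution. -/
def laguerreCoeff {d n : ℕ} (k : Fin d → ℕ) (α : Fin n → ℝ≥0)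
    (s : Matrix (Fin n) (Fin d) ℝ≥0) : ℝ :=
  ∫ x, laguerre k x ∂(gammaConv α s)

/-- The empirical Laguerre coefficient of a sample `x 1, …, x N`. -/
def empLaguerreCoeff {d N : ℕ} (k : Fin d → ℕ) (x : Fin N → Fin d → ℝ) : ℝ :=
  (1 / (N : ℝ)) * ∑ i, laguerre k (x i)

/-- The truncated loss `L_m(x, α, s)`, a sum over all multi-indices `k ≤ m`. -/
def truncLoss {d n N : ℕ} (m : Fin d → ℕ) (x : Fin N → Fin d → ℝ) (α : Fin n → ℝ≥0)
    (s : Matrix (Fin n) (Fin d) ℝ≥0) : ℝ :=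
  ∑ k ∈ Finset.Iic m, (empLaguerreCoeff k x - laguerreCoeff k α s) ^ 2

/-- `(α, s)` is a global minimizer of the truncated loss over the well-behaved parameters. -/
def IsLossMinimizer {d n N : ℕ} (m : Fin d → ℕ) (x : Fin N → Fin d → ℝ) (α : Fin n → ℝ≥0)
    (s : Matrix (Fin n) (Fin d) ℝ≥0) : Prop :=
  WellBehaved α s ∧
    ∀ (β : Fin n → ℝ≥0) (r : Matrix (Fin n) (Fin d) ℝ≥0), WellBehaved β r →
      truncLoss m x α s ≤ truncLoss m x β r

/-! Check of the definition of `gammaConv` against the cumulant generating function. -/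

lemma measurable_mixScales {d n : ℕ} (s : Matrix (Fin n) (Fin d) ℝ≥0) :
    Measurable (mixScales s) := by
  unfold mixScales
  fun_prop

instance gammaConv_isProbabilityMeasure {d n : ℕ} (α : Fin n → ℝ≥0)
    (s : Matrix (Fin n) (Fin d) ℝ≥0) : IsProbabilityMeasure (gammaConv α s) :=
  Measure.isProbabilityMeasure_map (measurable_mixScales s).aemeasurable

lemma hasMgf_stdGamma (a : ℝ≥0) {c : ℝ} (hc : c < 1) :
    Integrable (fun z => Real.exp (c * z)) (stdGamma a) ∧
      ∫ z, Real.exp (c * z) ∂(stdGamma a) = (1 - c) ^ (-(a : ℝ)) := by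
  by_cases h : a = 0
  · subst h
    simp [stdGamma, integrable_dirac]
  have ha : (0 : ℝ) < a := by positivity
  have hr : 0 < 1 - c := by linarith
  have key : ∀ z, gammaPDFReal a 1 z * Real.exp (c * z)
      = (1 - c) ^ (-(a : ℝ)) * gammaPDFReal a (1 - c) z := by
    intro z
    unfold gammaPDFReal
    split_ifs with hz
    · have e : Real.exp (-((1 - c) * z)) = Real.exp (-(1 * z)) * Real.exp (c * z) := by
        rw [← Real.exp_add]; ring_nf
      have p : (1 - c) ^ (-(a : ℝ)) * (1 - c) ^ (a : ℝ) = 1 := by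
        rw [← Real.rpow_add hr]; simp
      rw [e, Real.one_rpow]
      linear_combination (-(1 / Real.Gamma a * z ^ ((a : ℝ) - 1) * Real.exp (-(1 * z))
        * Real.exp (c * z))) * p
    · simp
  have hint : Integrable (gammaPDFReal a (1 - c)) := by
    refine ⟨by fun_prop, ?_⟩
    rw [hasFiniteIntegral_iff_ofReal (ae_of_all _ fun z => gammaPDFReal_nonneg ha hr z)]
    exact (lintegral_gammaPDF_eq_one ha hr).trans_lt ENNReal.one_lt_top
  have hone : ∫ z, gammaPDFReal a (1 - c) z = 1 := by
    rw [integral_eq_lintegral_of_nonneg_ae (ae_of_all _ fun z => gammaPDFReal_nonneg ha hr z)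
      (by fun_prop)]
    exact (congrArg ENNReal.toReal (lintegral_gammaPDF_eq_one ha hr)).trans ENNReal.toReal_one
  have hmeas : Measurable (gammaPDF a 1) := (measurable_gammaPDFReal a 1).ennreal_ofReal
  have hlt : ∀ᵐ z : ℝ, gammaPDF a 1 z < ∞ := ae_of_all _ fun z => ENNReal.ofReal_lt_top
  have hto : ∀ z, (gammaPDF a 1 z).toReal = gammaPDFReal a 1 z := fun z =>
    ENNReal.toReal_ofReal (gammaPDFReal_nonneg ha one_pos z)
  simp only [stdGamma, if_neg h, gammaMeasure]
  rw [integrable_withDensity_iff_integrable_smul' hmeas hlt,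
    integral_withDensity_eq_integral_toReal_smul hmeas hlt]
  simp only [hto, smul_eq_mul, key]
  exact ⟨hint.const_mul _, by rw [integral_const_mul, hone, mul_one]⟩

/-- The cumulant generating function of `gammaConv α s`. -/
theorem cgf_gammaConv {d n : ℕ} (α : Fin n → ℝ≥0) (s : Matrix (Fin n) (Fin d) ℝ≥0)
    (t : Fin d → ℝ) (ht : ∀ i, ∑ j, (s i j : ℝ) * t j < 1) :
    Integrable (fun x => Real.exp (∑ j, t j * x j)) (gammaConv α s) ∧
      Real.log (∫ x, Real.exp (∑ j, t j * x j) ∂(gammaConv α s)) =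
        ∑ i, -(α i : ℝ) * Real.log (1 - ∑ j, (s i j : ℝ) * t j) := by
  have hexp : ∀ z : Fin n → ℝ, Real.exp (∑ j, t j * mixScales s z j)
      = ∏ i, Real.exp ((∑ j, (s i j : ℝ) * t j) * z i) := by
    intro z
    rw [← Real.exp_sum]
    congr 1
    simp only [mixScales, Finset.mul_sum, Finset.sum_mul]
    rw [Finset.sum_comm]
    exact Finset.sum_congr rfl fun i _ => Finset.sum_congr rfl fun j _ => by ring
  have hm : AEStronglyMeasurable (fun x : Fin d → ℝ => Real.exp (∑ j, t j * x j))
      ((Measure.pi fun i => stdGamma (α i)).map (mixScales s)) := by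
    have : Measurable (fun x : Fin d → ℝ => Real.exp (∑ j, t j * x j)) := by fun_prop
    exact this.aestronglyMeasurable
  unfold gammaConv
  constructor
  · rw [integrable_map_measure hm (measurable_mixScales s).aemeasurable]
    simp only [Function.comp_def, hexp]
    exact Integrable.fintype_prod fun i => (hasMgf_stdGamma (α i) (ht i)).1
  · rw [integral_map (measurable_mixScales s).aemeasurable hm]
    simp only [hexp]
    rw [integral_fintype_prod_eq_prod (fun i z => Real.exp ((∑ j, (s i j : ℝ) * t j) * z)),
      Finset.prod_congr rfl fun i _ => (hasMgf_stdGamma (α i) (ht i)).2,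
      Real.log_prod fun i _ => (Real.rpow_pos_of_pos (sub_pos.2 (ht i)) _).ne']
    exact Finset.sum_congr rfl fun i _ => Real.log_rpow (sub_pos.2 (ht i)) _

end

/-! The randomness enters only through the strong law of large numbers: almost surely every
empirical Laguerre coefficient converges to the true one. The true parameters are a competitor in
the minimization and their truncated loss tends to `0`, so the coefficients of any minimizer, up to
order `m`, are eventually close to the true ones. What remains is a deterministic stability
statement, `exists_laguerreCoeff_close`: closeness of finitely many Laguerre coefficients forces
closeness of the densities in `L²`. It is proved by contradiction, along a sequence of parameters
all of whose coefficients converge.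

Compactness. The Laguerre functions span the terms of a power series for `e^{-⟨t, x⟩}`, so Laplace
transforms converge on `(0, 2)^d` (`tendsto_laplace_of_tendsto_laguerre`). A component of a gamma
convolution can converge, collapse to a deterministic drift (scale to `0`, shape possibly to
infinity), or send mass to infinity (scale to infinity, shape to `0`). The last two add a term `l *
U + V` to the Laplace exponent along the diagonal, which a sum of logarithms cannot absorb
(`affine_eq_zero_of_sum_log_eq`). Hence a subsequence of the parameters converges, up to negligible
components, to parameters of the same law (`exists_paramsConverge`).

From parameters to `L²`. By Plancherel it suffices to treat Fourier transforms, which are explicit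
products and converge pointwise; the difficulty is domination. A square integrable density cannot
concentrate near a subspace, which forces the shapes of the rows outside any proper subspace to add
up to more than half its codimension (`codim_lt_of_memLp_density`). A greedy choice of basis
(`exists_basis_sum_le`) turns this condition into a pointwise bound of the squared Fourier transform
by finitely many products of integrable one-variable brackets, one product for each basis of rows.
The condition is strict, so the bound survives a small perturbation of the parameters, and dominated
convergence with moving dominating functions concludes (`ParamsConverge.tendsto_eLpNorm`). -/

noncomputable section

/-! ### Greedy bases -/

open Module Submodule in
/-- If a basis `v ∘ B` extracted from a family has minimal weight, then a vector of weight at most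
`u` lies in the span of the basis vectors of weight at most `u`. -/
lemma mem_span_of_minimal_weight {d : ℕ} {ι : Type*} (v : ι → Fin d → ℝ) (y : ι → ℝ)
    (B : Fin d → ι) (hB : LinearIndependent ℝ (v ∘ B))
    (hmin : ∀ B' : Fin d → ι, LinearIndependent ℝ (v ∘ B') → ∑ k, y (B k) ≤ ∑ k, y (B' k))
    (u : ℝ) (i : ι) (hi : y i ≤ u) :
    v i ∈ span ℝ (v '' (B '' {k | y (B k) ≤ u})) := by
  classical
  by_contra hmem
  let b := Basis.mk hB (hB.span_eq_top_of_card_eq_finrank' (by simp)).ge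
  have hb : ∀ k, b k = v (B k) := fun k => by simp [b]
  have hex : ∃ k, b.repr (v i) k ≠ 0 ∧ u < y (B k) := by
    by_contra! hcon
    apply hmem
    rw [← b.sum_repr (v i)]
    refine sum_mem fun k _ => ?_
    by_cases hk : b.repr (v i) k = 0
    · simp [hk]
    · refine smul_mem _ _ (subset_span ?_)
      rw [hb]
      exact ⟨B k, ⟨k, hcon k hk, rfl⟩, rfl⟩
  -- Exchange argument: `v i` has a nonzero coordinate on a basis vector of weight above `u`, so
  -- swapping `i` in preserves independence and strictly lowers the total weight.
  obtain ⟨k, hk0, hku⟩ := hex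
  have hupd : v ∘ Function.update B k i = Function.update (v ∘ B) k (v i) :=
    Function.comp_update v B k i
  have hli : LinearIndependent ℝ (v ∘ Function.update B k i) := by
    rw [hupd]
    refine hB.update k (v i) ⟨1, one_mem _, b.repr (v i), (Ne.isUnit hk0).mem_nonZeroDivisors, ?_⟩
    have h0 := b.linearCombination_repr (v i)
    rw [Basis.coe_mk] at h0
    rw [one_smul, h0]
  have h1 := hmin _ hli
  have h2 : ∑ k', y (Function.update B k i k') = ∑ k', y (B k') + (y i - y (B k)) := by
    have : (fun k' => y (Function.update B k i k')) = Function.update (fun k' => y (B k')) k (y i) :=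
      Function.comp_update y B k i
    rw [this, Finset.sum_update_of_mem (Finset.mem_univ k),
      ← Finset.add_sum_erase _ _ (Finset.mem_univ k), Finset.sdiff_singleton_eq_erase]
    ring
  linarith

open Module Submodule in
lemma exists_basis_of_span_eq_top {d : ℕ} {ι : Type*} (v : ι → Fin d → ℝ)
    (h : span ℝ (Set.range v) = ⊤) : ∃ B : Fin d → ι, LinearIndependent ℝ (v ∘ B) := by
  obtain ⟨κ, a, -, ha, hli⟩ := exists_linearIndependent' ℝ v
  have : Finite κ := hli.finite
  cases nonempty_fintype κ
  have hcard : Fintype.card κ = d := by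
    have := finrank_span_eq_card hli
    rw [ha, h] at this
    simpa using this.symm
  let e : Fin d ≃ κ := (Fintype.equivFinOfCardEq hcard).symm
  exact ⟨a ∘ e, hli.comp e e.injective⟩

/-- The layer-cake formula for a single number; it lets an inequality proved level by level be
integrated. -/
lemma integral_Ioc_indicator_lt {M y : ℝ} (hy : 0 ≤ y) (hM : y ≤ M) :
    ∫ u in (0 : ℝ)..M, (if u < y then (1 : ℝ) else 0) = y := by
  rw [intervalIntegral.integral_of_le (hy.trans hM)]
  have h1 : ∀ᵐ u ∂(volume.restrict (Set.Ioc 0 M)), (if u < y then (1 : ℝ) else 0)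
      = (Set.Ioc 0 y).indicator (fun _ => (1 : ℝ)) u := by
    have hne : ∀ᵐ u : ℝ ∂(volume.restrict (Set.Ioc 0 M)), u ≠ y :=
      ae_restrict_of_ae (Measure.ae_ne volume y)
    filter_upwards [ae_restrict_mem measurableSet_Ioc, hne] with u hu hne
    have : (u < y) ↔ (0 < u ∧ u ≤ y) := ⟨fun h => ⟨hu.1, h.le⟩, fun h => lt_of_le_of_ne h.2 hne⟩
    simp [Set.indicator_apply, this]
  rw [integral_congr_ae h1, integral_indicator measurableSet_Ioc, setIntegral_const,
    Measure.real, Measure.restrict_apply measurableSet_Ioc, Set.inter_eq_left.2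
    (Set.Ioc_subset_Ioc_right hM)]
  simp [hy]

lemma intervalIntegrable_indicator_lt (M y : ℝ) :
    IntervalIntegrable (fun u : ℝ => if u < y then (1 : ℝ) else 0) volume 0 M := by
  refine AntitoneOn.intervalIntegrable fun a _ b _ hab => ?_
  by_cases h : b < y
  · simp [h, hab.trans_lt h]
  · simp only [h, if_false]
    split_ifs <;> norm_num

open Module Submodule in
open scoped Classical in
/-- **Greedy bases**: if the weights `w` outside of any span dominate the codimension of this span,
then every nonnegative cost function `y` has a basis of cost controlled by `∑ i, w i * y i`. -/
theorem exists_basis_sum_le {d : ℕ} {ι : Type*} [Fintype ι] (v : ι → Fin d → ℝ) (w : ι → ℝ)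
    (hw : ∀ i, 0 ≤ w i) {c : ℝ} (hc : 0 ≤ c)
    (h : ∀ S : Set ι, (d : ℝ) - finrank ℝ (span ℝ (v '' S)) ≤
      c * ∑ i, if v i ∈ span ℝ (v '' S) then 0 else w i)
    (y : ι → ℝ) (hy : ∀ i, 0 ≤ y i) :
    ∃ B : Fin d → ι, LinearIndependent ℝ (v ∘ B) ∧ ∑ k, y (B k) ≤ c * ∑ i, w i * y i := by
  have htop : span ℝ (Set.range v) = ⊤ := by
    -- With `S` everything, no weight lies outside the span, so the hypothesis forces full rank.
    have h1 := h Set.univ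
    rw [Set.image_univ] at h1
    have h2 : ∀ i, v i ∈ span ℝ (Set.range v) := fun i => subset_span ⟨i, rfl⟩
    simp only [h2, if_true, Finset.sum_const_zero, mul_zero, sub_nonpos, Nat.cast_le] at h1
    refine eq_top_of_finrank_eq (le_antisymm (finrank_le _) ?_)
    simpa using h1
  obtain ⟨B, hBmem, hmin⟩ := Set.exists_min_image
    {B : Fin d → ι | LinearIndependent ℝ (v ∘ B)} (fun B => ∑ k, y (B k)) (Set.toFinite _)
    (exists_basis_of_span_eq_top v htop)
  refine ⟨B, hBmem, ?_⟩
  have hspan := mem_span_of_minimal_weight v y B hBmem hmin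
  -- The left side counts the basis vectors of cost above `u`, which is the codimension of the span
  -- of the cheaper ones. By minimality every index of cost at most `u` lies in that span, so only
  -- indices of cost above `u` contribute to the weight outside it.
  have hlevel : ∀ u : ℝ, ∑ k, (if u < y (B k) then (1 : ℝ) else 0) ≤
      c * ∑ i, w i * (if u < y i then (1 : ℝ) else 0) := by
    intro u
    have hrank : finrank ℝ (span ℝ (v '' (B '' {k | y (B k) ≤ u})))
        = (Finset.univ.filter fun k => y (B k) ≤ u).card := by
      have h3 := finrank_span_eq_card
        (hBmem.comp (fun k : {k // y (B k) ≤ u} => k.1) Subtype.val_injective)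
      rw [Fintype.card_subtype] at h3
      rw [← h3, ← Set.image_comp, Set.range_comp (v ∘ B), Subtype.range_coe_subtype]
    have h4 := h (B '' {k | y (B k) ≤ u})
    have h5 : ∑ k, (if u < y (B k) then (1 : ℝ) else 0)
        = (d : ℝ) - finrank ℝ (span ℝ (v '' (B '' {k | y (B k) ≤ u}))) := by
      rw [hrank, eq_sub_iff_add_eq, ← Finset.sum_boole, ← Finset.sum_add_distrib]
      rw [Finset.sum_congr rfl (g := fun _ => (1 : ℝ))]
      · simp
      · intro k _
        by_cases hk : u < y (B k)
        · simp [hk]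
        · simp [hk, not_lt.1 hk]
    rw [h5]
    refine h4.trans (mul_le_mul_of_nonneg_left (Finset.sum_le_sum fun i _ => ?_) hc)
    by_cases hi : u < y i
    · simp only [hi, if_true, mul_one]
      split_ifs
      · exact hw i
      · exact le_rfl
    · rw [if_pos (hspan u i (not_lt.1 hi))]
      simp [hi]
  obtain ⟨M, hM⟩ : ∃ M, ∀ i, y i ≤ M :=
    ⟨∑ i, y i, fun i => Finset.single_le_sum (fun j _ => hy j) (Finset.mem_univ i)⟩
  have hM0 : 0 ≤ max M 0 := le_max_right _ _
  have hMi : ∀ i, y i ≤ max M 0 := fun i => (hM i).trans (le_max_left _ _)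
  have hint := intervalIntegral.integral_mono_on (μ := volume) hM0
    (IntervalIntegrable.sum Finset.univ fun k _ =>
      intervalIntegrable_indicator_lt (max M 0) (y (B k)))
    ((IntervalIntegrable.sum Finset.univ fun i _ =>
      (intervalIntegrable_indicator_lt (max M 0) (y i)).const_mul (w i)).const_mul c)
    (fun u _ => by simpa using hlevel u)
  simp only [Finset.sum_apply] at hint
  rw [intervalIntegral.integral_finsetSum fun k _ => intervalIntegrable_indicator_lt _ _,
    intervalIntegral.integral_const_mul, intervalIntegral.integral_finsetSum fun i _ =>
      (intervalIntegrable_indicator_lt (max M 0) (y i)).const_mul (w i)] at hint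
  simp only [intervalIntegral.integral_const_mul] at hint
  simpa only [integral_Ioc_indicator_lt (hy _) (hMi _)] using hint

/-! ### Gamma convolutions with a square integrable density are spread out -/

/-- The `i`-th row of a scale matrix, as a real vector. -/
def scaleVec {d n : ℕ} (s : Matrix (Fin n) (Fin d) ℝ≥0) (i : Fin n) : Fin d → ℝ :=
  fun j => (s i j : ℝ)

lemma mixScales_eq_sum {d n : ℕ} (s : Matrix (Fin n) (Fin d) ℝ≥0) (z : Fin n → ℝ) :
    mixScales s z = ∑ i, z i • scaleVec s i := by
  ext j
  simp [mixScales, scaleVec, Finset.sum_apply, mul_comm]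

/-- On `(0, 1]` the gamma density is at least `e⁻¹ x^(a - 1) / Γ(a)`, and integrating this gives
`κ`. For shape `0` the atom at `0` matches `ρ ^ 0 = 1`. -/
lemma exists_le_stdGamma_Icc (a : ℝ≥0) :
    ∃ κ : ℝ, 0 < κ ∧ ∀ ρ : ℝ, 0 < ρ → ρ ≤ 1 →
      ENNReal.ofReal (κ * ρ ^ (a : ℝ)) ≤ stdGamma a (Set.Icc 0 ρ) := by
  by_cases h : a = 0
  · subst h
    exact ⟨1, one_pos, fun ρ hρ _ => by simp [stdGamma, hρ.le]⟩
  have ha : (0 : ℝ) < a := by positivity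
  have hΓ := Real.Gamma_pos_of_pos ha
  refine ⟨Real.exp (-1) / Real.Gamma a / a, by positivity, fun ρ hρ hρ1 => ?_⟩
  have hii : IntervalIntegrable (fun x : ℝ => Real.exp (-1) / Real.Gamma a * x ^ ((a : ℝ) - 1))
      volume 0 ρ := (intervalIntegral.intervalIntegrable_rpow' (by linarith)).const_mul _
  have h1 : ∫ x in Set.Ioc 0 ρ, Real.exp (-1) / Real.Gamma a * x ^ ((a : ℝ) - 1)
      = Real.exp (-1) / Real.Gamma a / a * ρ ^ (a : ℝ) := by
    rw [← intervalIntegral.integral_of_le hρ.le, intervalIntegral.integral_const_mul,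
      integral_rpow (Or.inl (by linarith)), sub_add_cancel, Real.zero_rpow ha.ne']
    ring
  rw [← h1, ofReal_integral_eq_lintegral_ofReal
    ((intervalIntegrable_iff_integrableOn_Ioc_of_le hρ.le).1 hii)]
  · simp only [stdGamma, if_neg h, gammaMeasure]
    rw [withDensity_apply _ measurableSet_Icc]
    refine le_trans ?_ (lintegral_mono_set Set.Ioc_subset_Icc_self)
    refine setLIntegral_mono_ae' measurableSet_Ioc (ae_of_all _ fun x hx => ?_)
    rw [gammaPDF_of_nonneg hx.1.le]
    refine ENNReal.ofReal_le_ofReal ?_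
    rw [Real.one_rpow, one_mul]
    have he : Real.exp (-1) ≤ Real.exp (-x) := Real.exp_le_exp.2 (by linarith [hx.2])
    have hx0 : 0 ≤ x ^ ((a : ℝ) - 1) := Real.rpow_nonneg hx.1.le _
    calc Real.exp (-1) / Real.Gamma a * x ^ ((a : ℝ) - 1)
        = 1 / Real.Gamma a * x ^ ((a : ℝ) - 1) * Real.exp (-1) := by ring
      _ ≤ _ := by gcongr
  · filter_upwards [ae_restrict_mem measurableSet_Ioc] with x hx
    have : 0 ≤ x ^ ((a : ℝ) - 1) := Real.rpow_nonneg hx.1.le _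
    simp only [Pi.zero_apply]
    positivity

/-- Linear coordinates adapted to a subspace. -/
lemma exists_adapted_coordinates {d : ℕ} (W : Submodule ℝ (Fin d → ℝ)) :
    ∃ k c : ℕ, Module.finrank ℝ W = k ∧ k + c = d ∧
      ∃ T : (Fin d → ℝ) ≃ₗ[ℝ] (Fin k ⊕ Fin c → ℝ),
        ∀ x ∈ W, ∀ j, T x (Sum.inr j) = 0 := by
  obtain ⟨W', hW'⟩ := W.exists_isCompl
  refine ⟨Module.finrank ℝ W, Module.finrank ℝ W', rfl, ?_, ?_⟩
  · simpa using Submodule.finrank_add_eq_of_isCompl hW'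
  · let b := ((Module.finBasis ℝ W).prod (Module.finBasis ℝ W')).map
      (W.prodEquivOfIsCompl W' hW')
    refine ⟨b.equivFun, fun x hx j => ?_⟩
    have := Submodule.prodEquivOfIsCompl_symm_apply_left W W' hW' ⟨x, hx⟩
    simp [b, this]

/-- The volume of a preimage of a box under a linear equivalence is proportional to the volume of
the box. -/
lemma exists_volume_preimage_eq {d : ℕ} {ι : Type*} [Fintype ι] (T : (Fin d → ℝ) ≃ₗ[ℝ] (ι → ℝ)) :
    ∃ C : ℝ≥0, ∀ E : Set (ι → ℝ), MeasurableSet E → volume (T ⁻¹' E) = C * volume E := by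
  let e := T.toContinuousLinearEquiv
  have hm : Measurable T := e.continuous.measurable
  have : (Measure.map T volume).IsAddHaarMeasure := e.isAddHaarMeasure_map volume
  have h := Measure.isAddLeftInvariant_eq_smul (Measure.map T volume) volume
  refine ⟨(Measure.map T volume).addHaarScalarFactor volume, fun E hE => ?_⟩
  rw [← Measure.map_apply hm hE]
  exact congrArg (fun ν => ν E) h

/-- Cauchy–Schwarz against the constant `1` on `E`. -/
lemma lintegral_sq_le {X : Type*} [MeasurableSpace X] {ν : Measure X} (E : Set X)
    (G : X → ℝ≥0∞) (hG : AEMeasurable G ν) :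
    (∫⁻ x in E, G x ∂ν) ^ 2 ≤ (∫⁻ x in E, G x ^ 2 ∂ν) * ν E := by
  have h := ENNReal.lintegral_mul_le_Lp_mul_Lq (ν.restrict E) Real.HolderConjugate.two_two
    hG.restrict (aemeasurable_const (b := (1 : ℝ≥0∞)))
  simp only [Pi.mul_apply, mul_one, ENNReal.one_rpow, lintegral_const,
    Measure.restrict_apply_univ, one_mul] at h
  have h2 := pow_le_pow_left' h 2
  rw [mul_pow, ← ENNReal.rpow_natCast (_ ^ (1 / 2 : ℝ)), ← ENNReal.rpow_natCast (_ ^ (1 / 2 : ℝ)),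
    ← ENNReal.rpow_mul, ← ENNReal.rpow_mul] at h2
  norm_num at h2
  simpa using h2

/-- The lower bound for the mass that a gamma convolution gives to thin boxes around a subspace. -/
lemma exists_le_gammaConv_box {d n : ℕ} (α : Fin n → ℝ≥0) (s : Matrix (Fin n) (Fin d) ℝ≥0)
    (W : Submodule ℝ (Fin d → ℝ)) {ι κ : Type*} [Fintype ι] [Fintype κ]
    (T : (Fin d → ℝ) ≃ₗ[ℝ] (ι ⊕ κ → ℝ)) (hT : ∀ x ∈ W, ∀ j, T x (Sum.inr j) = 0) :
    open scoped Classical in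
    ∃ δ M : ℝ, 0 < δ ∧ 0 ≤ M ∧ ∀ r : ℝ, 0 < r → r ≤ 1 →
      ENNReal.ofReal (δ * r ^ (∑ i, if scaleVec s i ∈ W then 0 else (α i : ℝ))) ≤
        gammaConv α s (T ⁻¹' Set.pi Set.univ
          (Sum.elim (fun _ => Set.Icc (-M) M) (fun _ => Set.Icc (-r) r))) := by
  classical
  choose δ hδ hδle using fun i => exists_le_stdGamma_Icc (α i)
  set K : ℝ := 1 + ∑ i, ∑ j, |T (scaleVec s i) j| with hKdef
  have hS0 : ∀ i j, 0 ≤ |T (scaleVec s i) j| := fun i j => abs_nonneg _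
  have hK : 1 ≤ K := by
    have : 0 ≤ ∑ i, ∑ j, |T (scaleVec s i) j| :=
      Finset.sum_nonneg fun i _ => Finset.sum_nonneg fun j _ => hS0 i j
    linarith
  have hKj : ∀ j, ∑ i, |T (scaleVec s i) j| ≤ K := by
    intro j
    have : ∑ i, |T (scaleVec s i) j| ≤ ∑ i, ∑ j, |T (scaleVec s i) j| :=
      Finset.sum_le_sum fun i _ =>
        Finset.single_le_sum (f := fun j => |T (scaleVec s i) j|) (fun j _ => hS0 i j)
          (Finset.mem_univ j)
    linarith
  have hK0 : 0 < K := by linarith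
  set A : ℝ := ∑ i, if scaleVec s i ∈ W then 0 else (α i : ℝ) with hA
  refine ⟨(∏ i, δ i) * K⁻¹ ^ A, K, mul_pos (Finset.prod_pos fun i _ => hδ i)
    (Real.rpow_pos_of_pos (by positivity) _), hK0.le, fun r hr hr1 => ?_⟩
  -- Consider the event that `Z i ≤ 1` for rows in `W` and `Z i ≤ r / K` for the others. Rows in `W`
  -- do not move the transversal coordinates, and the others move them by at most `r` in total. By
  -- independence the probabilities multiply, and only the rows outside `W` cost a power of `r`.
  set ρ : Fin n → ℝ := fun i => if scaleVec s i ∈ W then 1 else K⁻¹ * r with hρ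
  have hρ0 : ∀ i, 0 < ρ i := fun i => by
    simp only [hρ]; split_ifs <;> positivity
  have hKr : K⁻¹ * r ≤ 1 := by
    have : K⁻¹ ≤ 1 := inv_le_one_of_one_le₀ hK
    have h0 : 0 < K⁻¹ := by positivity
    nlinarith
  have hρ1 : ∀ i, ρ i ≤ 1 := fun i => by
    simp only [hρ]; split_ifs <;> linarith
  have hE : MeasurableSet (T ⁻¹' Set.pi Set.univ (Sum.elim (fun _ : ι => Set.Icc (-K) K)
      (fun _ : κ => Set.Icc (-r) r))) := by
    have hm : Measurable T := T.toContinuousLinearEquiv.continuous.measurable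
    refine hm (MeasurableSet.univ_pi fun j => ?_)
    cases j <;> exact measurableSet_Icc
  rw [gammaConv, Measure.map_apply (measurable_mixScales s) hE]
  have hsub : Set.pi Set.univ (fun i => Set.Icc 0 (ρ i)) ⊆ mixScales s ⁻¹' (T ⁻¹' Set.pi Set.univ
      (Sum.elim (fun _ : ι => Set.Icc (-K) K) (fun _ : κ => Set.Icc (-r) r))) := by
    intro z hz
    have hz0 : ∀ i, 0 ≤ z i := fun i => (hz i trivial).1
    have hz1 : ∀ i, z i ≤ ρ i := fun i => (hz i trivial).2
    have habs : ∀ j, |T (mixScales s z) j| ≤ ∑ i, z i * |T (scaleVec s i) j| := by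
      intro j
      rw [mixScales_eq_sum, map_sum, Finset.sum_apply]
      refine (Finset.abs_sum_le_sum_abs _ _).trans (Finset.sum_le_sum fun i _ => ?_)
      rw [map_smul, Pi.smul_apply, smul_eq_mul, abs_mul, abs_of_nonneg (hz0 i)]
    rw [Set.mem_preimage, Set.mem_preimage, Set.mem_univ_pi]
    rintro (j | j)
    · simp only [Sum.elim_inl, Set.mem_Icc, ← abs_le]
      refine (habs _).trans (le_trans (Finset.sum_le_sum fun i _ => ?_) (hKj (Sum.inl j)))
      exact mul_le_of_le_one_left (hS0 _ _) ((hz1 i).trans (hρ1 i))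
    · simp only [Sum.elim_inr, Set.mem_Icc, ← abs_le]
      have hstep : ∀ i, z i * |T (scaleVec s i) (Sum.inr j)| ≤
          K⁻¹ * r * |T (scaleVec s i) (Sum.inr j)| := by
        intro i
        by_cases hi : scaleVec s i ∈ W
        · simp [hT _ hi j]
        · have := hz1 i
          simp only [hρ, if_neg hi] at this
          exact mul_le_mul_of_nonneg_right this (hS0 _ _)
      refine (habs _).trans ((Finset.sum_le_sum fun i _ => hstep i).trans ?_)
      rw [← Finset.mul_sum]
      calc K⁻¹ * r * ∑ i, |T (scaleVec s i) (Sum.inr j)| ≤ K⁻¹ * r * K :=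
            mul_le_mul_of_nonneg_left (hKj _) (by positivity)
        _ = r := by field_simp
  refine le_trans ?_ (measure_mono hsub)
  rw [Measure.pi_pi]
  refine le_trans (le_of_eq ?_) (Finset.prod_le_prod' fun i _ => hδle i (ρ i) (hρ0 i) (hρ1 i))
  rw [← ENNReal.ofReal_prod_of_nonneg fun i _ =>
    mul_nonneg (hδ i).le (Real.rpow_nonneg (hρ0 i).le _), Finset.prod_mul_distrib]
  congr 1
  rw [mul_assoc, ← Real.mul_rpow (by positivity) hr.le, hA, Real.rpow_sum_of_pos (by positivity)]
  congr 1
  refine Finset.prod_congr rfl fun i _ => ?_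
  by_cases hi : scaleVec s i ∈ W <;> simp [hρ, hi]

open scoped Classical in
/-- If a gamma convolution has a square integrable density, then the shapes of the scale vectors
outside of a proper subspace add up to more than half of the codimension. -/
theorem codim_lt_of_memLp_density {d n : ℕ} (α : Fin n → ℝ≥0) (s : Matrix (Fin n) (Fin d) ℝ≥0)
    (hdens : gammaConv α s ≪ volume) (hL2 : MemLp (gammaConvDensity α s) 2 volume)
    (W : Submodule ℝ (Fin d → ℝ)) (hW : W ≠ ⊤) :
    (d : ℝ) - Module.finrank ℝ W < 2 * ∑ i, if scaleVec s i ∈ W then 0 else (α i : ℝ) := by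
  obtain ⟨k, c, hk, hc, T, hT⟩ := exists_adapted_coordinates W
  obtain ⟨δ, M, hδ, hM, hlow⟩ := exists_le_gammaConv_box α s W T hT
  obtain ⟨C, hC⟩ := exists_volume_preimage_eq T
  set A : ℝ := ∑ i, if scaleVec s i ∈ W then 0 else (α i : ℝ) with hA
  have hc0 : c ≠ 0 := by
    rintro rfl
    apply hW
    apply Submodule.eq_top_of_finrank_eq
    simpa [hk] using hc
  have hdc : (d : ℝ) - Module.finrank ℝ W = c := by
    rw [hk, ← hc]
    push_cast
    ring
  rw [hdc]
  -- The box `E r` has volume of order `r ^ c` and mass at least `δ * r ^ A`, so by Cauchy–Schwarz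
  -- `δ ^ 2 * r ^ (2 * A)` is at most `C' * r ^ c` times the integral of `G ^ 2` over `E r`. If `2 *
  -- A ≤ c` the powers of `r` cancel for `r ≤ 1`. Since `c > 0` the volume of `E r` tends to `0`,
  -- hence so does that integral, which is absurd.
  by_contra! hle
  set E : ℝ → Set (Fin d → ℝ) := fun r => T ⁻¹' Set.pi Set.univ
    (Sum.elim (fun _ : Fin k => Set.Icc (-M) M) (fun _ : Fin c => Set.Icc (-r) r)) with hE
  have hEm : ∀ r, MeasurableSet (Set.pi Set.univ
      (Sum.elim (fun _ : Fin k => Set.Icc (-M) M) (fun _ : Fin c => Set.Icc (-r) r))) := by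
    intro r
    refine MeasurableSet.univ_pi fun j => ?_
    cases j <;> exact measurableSet_Icc
  set C' : ℝ≥0∞ := C * ENNReal.ofReal (2 * M) ^ k * 2 ^ c with hC'
  have hC'top : C' ≠ ∞ := by
    simp only [hC']
    finiteness
  have hvol : ∀ r : ℝ, 0 ≤ r → volume (E r) = C' * ENNReal.ofReal r ^ c := by
    intro r hr
    simp only [hE]
    rw [hC _ (hEm r), volume_pi_pi]
    simp only [Fintype.prod_sum_type, Sum.elim_inl, Sum.elim_inr, Real.volume_Icc,
      Finset.prod_const, Finset.card_univ, Fintype.card_fin, sub_neg_eq_add, ← two_mul]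
    rw [ENNReal.ofReal_mul (p := 2) (q := r) (by norm_num), mul_pow, hC']
    simp
    ring
  set G : (Fin d → ℝ) → ℝ≥0∞ := (gammaConv α s).rnDeriv volume with hG
  have hGm : Measurable G := Measure.measurable_rnDeriv _ _
  have hGfin : ∫⁻ x, G x ^ 2 ≠ ∞ := by
    have h := hL2.eLpNorm_lt_top
    rw [eLpNorm_lt_top_iff_lintegral_rpow_enorm_lt_top (by norm_num) (by norm_num)] at h
    refine (lt_of_eq_of_lt (lintegral_congr_ae ?_) h).ne
    filter_upwards [Measure.rnDeriv_lt_top (gammaConv α s) volume] with x hx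
    simp [gammaConvDensity, Real.enorm_of_nonneg ENNReal.toReal_nonneg,
      ENNReal.ofReal_toReal hx.ne, hG]
  have hmass : ∀ r, gammaConv α s (E r) = ∫⁻ x in E r, G x := fun r =>
    (Measure.setLIntegral_rnDeriv hdens (E r)).symm
  have hkey : ∀ r : ℝ, 0 < r → r ≤ 1 →
      ENNReal.ofReal (δ ^ 2) ≤ (∫⁻ x in E r, G x ^ 2) * C' := by
    intro r hr hr1
    have h1 := pow_le_pow_left' ((hlow r hr hr1).trans (hmass r).le) 2
    have h2 := h1.trans (lintegral_sq_le (E r) G hGm.aemeasurable)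
    rw [hvol r hr.le, ← ENNReal.ofReal_pow (by positivity), mul_pow, ← mul_assoc,
      ENNReal.ofReal_mul (by positivity), ← ENNReal.ofReal_pow hr.le] at h2
    have h3 : r ^ c ≤ (r ^ A) ^ 2 := by
      rw [← Real.rpow_natCast (r ^ A), ← Real.rpow_mul hr.le, ← Real.rpow_natCast]
      exact Real.rpow_le_rpow_of_exponent_ge hr hr1 (by push_cast; linarith)
    have h4 : ENNReal.ofReal (δ ^ 2) * ENNReal.ofReal (r ^ c) ≤
        (∫⁻ x in E r, G x ^ 2) * C' * ENNReal.ofReal (r ^ c) :=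
      (mul_le_mul_right (ENNReal.ofReal_le_ofReal h3) _).trans h2
    have hrc : 0 < r ^ c := by positivity
    exact (ENNReal.mul_le_mul_iff_left (ENNReal.ofReal_pos.2 hrc).ne' ENNReal.ofReal_ne_top).1 h4
  have hr0 : Tendsto (fun p : ℕ => 1 / ((p : ℝ) + 1)) atTop (nhds 0) :=
    tendsto_one_div_add_atTop_nhds_zero_nat
  have hvol0 : Tendsto (volume ∘ fun p : ℕ => E (1 / ((p : ℝ) + 1))) atTop (nhds 0) := by
    have h5 : Tendsto (fun p : ℕ => C' * ENNReal.ofReal (1 / ((p : ℝ) + 1)) ^ c) atTop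
        (nhds (C' * ENNReal.ofReal 0 ^ c)) :=
      ENNReal.Tendsto.const_mul (((ENNReal.continuous_pow c).tendsto _).comp
        (ENNReal.tendsto_ofReal hr0)) (Or.inr hC'top)
    simp only [ENNReal.ofReal_zero, zero_pow hc0, mul_zero] at h5
    refine h5.congr fun p => ?_
    simp only [Function.comp]
    rw [hvol _ (by positivity)]
  have hlim := tendsto_setLIntegral_zero hGfin hvol0
  have hlim2 := ENNReal.Tendsto.mul_const (b := C') hlim (Or.inr hC'top)
  rw [zero_mul] at hlim2
  have hle0 : ENNReal.ofReal (δ ^ 2) ≤ 0 := by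
    refine ge_of_tendsto' hlim2 fun p => hkey _ (by positivity) ?_
    rw [div_le_one (by positivity)]
    linarith [(Nat.cast_nonneg p : (0 : ℝ) ≤ p)]
  have : 0 < ENNReal.ofReal (δ ^ 2) := ENNReal.ofReal_pos.2 (by positivity)
  exact absurd hle0 (not_le.2 this)

/-! ### Measures with a square integrable Fourier transform -/

section MeasureFourier

open scoped FourierTransform SchwartzMap InnerProductSpace

variable {E : Type*} [NormedAddCommGroup E] [InnerProductSpace ℝ E] [FiniteDimensional ℝ E]

open scoped Manifold ContDiff in
lemma exists_smooth_between {K U : Set E} (hK : IsCompact K) (hU : IsOpen U) (hKU : K ⊆ U) :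
    ∃ f : E → ℝ, ContDiff ℝ ∞ f ∧ HasCompactSupport f ∧ (∀ x, 0 ≤ f x ∧ f x ≤ 1) ∧
      (∀ x ∉ U, f x = 0) ∧ ∀ x ∈ K, f x = 1 := by
  obtain ⟨V, hV, hKV, hVU, hVc⟩ := exists_open_between_and_isCompact_closure hK hU hKU
  obtain ⟨f, hf, hr, hs, h1⟩ := exists_contMDiff_support_eq_eq_one_iff 𝓘(ℝ, E) (n := ⊤) hV
    hK.isClosed hKV
  refine ⟨f, hf.contDiff, ?_, fun x => hr ⟨x, rfl⟩, fun x hx => ?_, fun x hx => (h1 x).1 hx⟩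
  · rw [HasCompactSupport, tsupport, hs]
    exact hVc
  · by_contra hne
    have : x ∈ Function.support f := hne
    rw [hs] at this
    exact hx (hVU (subset_closure this))

variable [MeasurableSpace E] [BorelSpace E]

/-- The Fourier transform of a measure, with the normalization `e^{-2πi⟨x, ξ⟩}`. -/
def measureFourier (μ : Measure E) (ξ : E) : ℂ :=
  VectorFourier.fourierIntegral 𝐞 μ (innerₗ E) (fun _ => (1 : ℂ)) ξ

/-- Fubini moves the Fourier transform from the measure to the test function. -/
lemma integral_measureFourier_mul (μ : Measure E) [IsFiniteMeasure μ] (φ : 𝓢(E, ℂ)) :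
    ∫ ξ, φ ξ • measureFourier μ ξ = ∫ x, (𝓕 φ) x ∂μ := by
  have h := VectorFourier.integral_fourierIntegral_smul_eq_flip (μ := μ) (ν := volume)
    (L := innerₗ E) (f := fun _ => (1 : ℂ)) (g := φ) Real.continuous_fourierChar
    continuous_inner (integrable_const _) φ.integrable
  simp only [one_smul, flip_innerₗ] at h
  simp only [smul_eq_mul, measureFourier] at h ⊢
  simp_rw [mul_comm (φ _)]
  rw [h]
  rfl

/-- A finite measure with square integrable Fourier transform agrees, against Schwartz functions,
with the inverse Fourier transform in `L²`. -/
lemma integral_schwartz_eq (μ : Measure E) [IsFiniteMeasure μ]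
    (h : MemLp (measureFourier μ) 2 volume) (ψ : 𝓢(E, ℂ)) :
    ∫ x, ψ x ∂μ = ∫ x, ψ x • (𝓕⁻ (h.toLp _) : Lp ℂ 2 (volume : Measure E)) x := by
  set g : Lp ℂ 2 (volume : Measure E) := 𝓕⁻ (h.toLp _) with hg
  set φ : 𝓢(E, ℂ) := 𝓕⁻ ψ with hφ
  -- With `ψ` written as the Fourier transform of `φ`, both sides become the pairing of `φ` with
  -- `measureFourier μ`: the left by Fubini, the right because the Fourier transform on `L²` agrees
  -- with that of tempered distributions.
  have hψ : 𝓕 φ = ψ := FourierTransform.fourier_fourierInv_eq ψ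
  have h1 : 𝓕 g = h.toLp _ := FourierTransform.fourier_fourierInv_eq _
  have h2 := congrArg (fun T => T φ) (Lp.fourier_toTemperedDistribution_eq g)
  simp only [TemperedDistribution.fourier_apply, h1, hψ, Lp.toTemperedDistribution_apply] at h2
  rw [h2, ← hψ, ← integral_measureFourier_mul]
  refine integral_congr_ae ?_
  filter_upwards [h.coeFn_toLp] with x hx
  rw [hx]

/-- Inner regularity reduces to a compact `K ⊆ U`; a smooth cutoff between `K` and `U` is then an
admissible test function. -/
lemma measure_isOpen_le_lintegral (μ : Measure E) [IsFiniteMeasure μ]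
    (h : MemLp (measureFourier μ) 2 volume) {U : Set E} (hU : IsOpen U) :
    μ U ≤ ∫⁻ x in U, ‖(𝓕⁻ (h.toLp _) : Lp ℂ 2 (volume : Measure E)) x‖ₑ := by
  set g : Lp ℂ 2 (volume : Measure E) := 𝓕⁻ (h.toLp _) with hg
  rw [hU.measure_eq_iSup_isCompact]
  refine iSup₂_le fun K hKU => iSup_le fun hK => ?_
  obtain ⟨f, hf, hfc, hf01, hfU, hfK⟩ := exists_smooth_between hK hU hKU
  have hfc' : HasCompactSupport (Complex.ofRealCLM ∘ f) := hfc.comp_left rfl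
  let ψ : 𝓢(E, ℂ) := hfc'.toSchwartzMap (Complex.ofRealCLM.contDiff.comp hf)
  have hψ : ∀ x, ψ x = (f x : ℂ) := fun x => rfl
  have h1 := integral_schwartz_eq μ h ψ
  simp only [hψ] at h1
  rw [integral_complex_ofReal] at h1
  have hfi : Integrable f μ :=
    (integrable_const (1 : ℝ)).mono' hf.continuous.aestronglyMeasurable
      (ae_of_all _ fun x => by
        rw [Real.norm_of_nonneg (hf01 x).1]
        exact (hf01 x).2)
  have h2 : μ K ≤ ‖((∫ x, f x ∂μ : ℝ) : ℂ)‖ₑ := by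
    have h3 : μ K ≤ ∫⁻ x, ENNReal.ofReal (f x) ∂μ := by
      rw [← lintegral_indicator_one hK.measurableSet]
      refine lintegral_mono fun x => ?_
      by_cases hx : x ∈ K
      · simp [hx, hfK x hx]
      · simp [hx]
    rw [← ofReal_integral_eq_lintegral_ofReal hfi (ae_of_all _ fun x => (hf01 x).1)] at h3
    refine h3.trans (le_of_eq ?_)
    rw [← ofReal_norm, Complex.norm_real,
      Real.norm_of_nonneg (integral_nonneg fun x => (hf01 x).1)]
  rw [h1] at h2
  refine h2.trans ((enorm_integral_le_lintegral_enorm _).trans ?_)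
  rw [← lintegral_indicator hU.measurableSet]
  refine lintegral_mono fun x => ?_
  by_cases hx : x ∈ U
  · rw [Set.indicator_of_mem hx, enorm_smul]
    refine mul_le_of_le_one_left' ?_
    rw [← ofReal_norm, Complex.norm_real, Real.norm_of_nonneg (hf01 x).1]
    exact ENNReal.ofReal_le_one.2 (hf01 x).2
  · simp [hfU x hx]

lemma lintegral_enorm_sq_ne_top {X F : Type*} [MeasurableSpace X] [NormedAddCommGroup F]
    {ν : Measure X} {g : X → F} (hg : MemLp g 2 ν) : ∫⁻ x, ‖g x‖ₑ ^ 2 ∂ν ≠ ∞ := by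
  have h := hg.eLpNorm_lt_top
  rw [eLpNorm_lt_top_iff_lintegral_rpow_enorm_lt_top (by norm_num) (by norm_num)] at h
  simpa using h.ne

/-- A finite measure with square integrable Fourier transform is absolutely continuous. -/
theorem absolutelyContinuous_of_memLp_measureFourier (μ : Measure E) [IsFiniteMeasure μ]
    (h : MemLp (measureFourier μ) 2 volume) : μ ≪ volume := by
  set g : Lp ℂ 2 (volume : Measure E) := 𝓕⁻ (h.toLp _) with hg
  have hgfin := lintegral_enorm_sq_ne_top (Lp.memLp g)
  set C := ∫⁻ x, ‖g x‖ₑ ^ 2 with hC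
  intro N hN
  -- By Cauchy–Schwarz `μ U` is controlled by the volume of `U` for all open sets with one constant,
  -- and outer regularity of the volume carries this over to null sets.
  have hbound : ∀ U, IsOpen U → μ U ^ 2 ≤ C * volume U := by
    intro U hU
    refine (pow_le_pow_left' (measure_isOpen_le_lintegral μ h hU) 2).trans ?_
    refine (lintegral_sq_le U _ (Lp.aestronglyMeasurable g).enorm).trans ?_
    gcongr
    exact setLIntegral_le_lintegral _ _
  have hsq : μ N ^ 2 ≤ 0 := by
    refine le_of_forall_pos_le_add fun ε hε => ?_
    obtain ⟨δ, hδ, hδε⟩ : ∃ δ : ℝ≥0∞, δ ≠ 0 ∧ C * δ ≤ ε := by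
      by_cases hC0 : C = 0
      · exact ⟨1, one_ne_zero, by simp [hC0]⟩
      · exact ⟨ε / C, (ENNReal.div_pos hε.ne' hgfin).ne', ENNReal.mul_div_le⟩
    obtain ⟨U, hNU, hU, hUδ⟩ := N.exists_isOpen_le_add (volume : Measure E) hδ
    rw [hN, zero_add] at hUδ
    rw [zero_add]
    exact (pow_le_pow_left' (measure_mono hNU) 2).trans ((hbound U hU).trans
      ((mul_le_mul_right hUδ _).trans hδε))
  simpa using hsq

/-- The density of a finite measure with square integrable Fourier transform. -/
theorem rnDeriv_eq_fourierInv (μ : Measure E) [IsFiniteMeasure μ]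
    (h : MemLp (measureFourier μ) 2 volume) :
    (fun x => ((μ.rnDeriv volume x).toReal : ℂ)) =ᵐ[volume]
      (𝓕⁻ (h.toLp _) : Lp ℂ 2 (volume : Measure E)) := by
  have hac := absolutelyContinuous_of_memLp_measureFourier μ h
  refine ae_eq_of_integral_contDiff_smul_eq
    (Measure.integrable_toReal_rnDeriv.ofReal.locallyIntegrable)
    ((Lp.memLp _).locallyIntegrable (by norm_num)) fun f hf hfc => ?_
  have hfc' : HasCompactSupport (Complex.ofRealCLM ∘ f) := hfc.comp_left rfl
  let ψ : 𝓢(E, ℂ) := hfc'.toSchwartzMap (Complex.ofRealCLM.contDiff.comp hf)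
  have hψ : ∀ x, ψ x = (f x : ℂ) := fun x => rfl
  have h1 := integral_schwartz_eq μ h ψ
  rw [← integral_rnDeriv_smul hac] at h1
  simp only [hψ] at h1
  have h2 : ∀ (r : ℝ) (z : ℂ), (r : ℂ) • z = r • z := fun r z => by simp
  simp only [h2] at h1
  rw [← h1]
  refine integral_congr_ae (ae_of_all _ fun x => ?_)
  simp [mul_comm]

/-- **Plancherel** for the densities of finite measures. -/
theorem eLpNorm_density_sub (μ ν : Measure E) [IsFiniteMeasure μ] [IsFiniteMeasure ν]
    (hμ : MemLp (measureFourier μ) 2 volume) (hν : MemLp (measureFourier ν) 2 volume) :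
    eLpNorm (fun x => (μ.rnDeriv volume x).toReal - (ν.rnDeriv volume x).toReal) 2 volume =
      eLpNorm (measureFourier μ - measureFourier ν) 2 volume := by
  have h1 : eLpNorm (fun x => (μ.rnDeriv volume x).toReal - (ν.rnDeriv volume x).toReal) 2 volume
      = eLpNorm ((𝓕⁻ (hμ.toLp _) - 𝓕⁻ (hν.toLp _) : Lp ℂ 2 (volume : Measure E)) : E → ℂ) 2
        volume := by
    refine eLpNorm_congr_norm_ae ?_
    filter_upwards [rnDeriv_eq_fourierInv μ hμ, rnDeriv_eq_fourierInv ν hν,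
      Lp.coeFn_sub (𝓕⁻ (hμ.toLp _) : Lp ℂ 2 (volume : Measure E)) (𝓕⁻ (hν.toLp _))] with x hx hy hs
    rw [hs, Pi.sub_apply, ← hx, ← hy, ← Complex.ofReal_sub, Complex.norm_real]
  have h2 : (𝓕⁻ (hμ.toLp _) - 𝓕⁻ (hν.toLp _) : Lp ℂ 2 (volume : Measure E))
      = 𝓕⁻ ((hμ.sub hν).toLp _) := by
    rw [MemLp.toLp_sub hμ hν]
    exact ((Lp.fourierTransformₗᵢ E ℂ).symm.map_sub _ _).symm
  have h3 : ‖(𝓕⁻ ((hμ.sub hν).toLp _) : Lp ℂ 2 (volume : Measure E))‖ = ‖(hμ.sub hν).toLp _‖ :=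
    (Lp.fourierTransformₗᵢ E ℂ).symm.norm_map _
  rw [h1, h2, ← Lp.enorm_def, ← ofReal_norm, h3, ofReal_norm, Lp.enorm_def]
  exact eLpNorm_congr_ae (MemLp.coeFn_toLp _)

end MeasureFourier

/-! ### The Fourier transform of gamma convolutions -/

open scoped Topology in
/-- The identity theorem on a vertical strip, for functions that agree near a real point. -/
lemma eqOn_strip_of_eventuallyEq {f g : ℂ → ℂ} {S : Set ℝ} (hS : Convex ℝ S)
    (hf : AnalyticOnNhd ℂ f {z | z.re ∈ S}) (hg : AnalyticOnNhd ℂ g {z | z.re ∈ S})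
    {t : ℝ} (ht : t ∈ S) (h : ∀ᶠ x : ℝ in 𝓝[≠] t, f x = g x) :
    Set.EqOn f g {z | z.re ∈ S} := by
  refine AnalyticOnNhd.eqOn_of_preconnected_of_frequently_eq hf hg
    (hS.linear_preimage Complex.reLm).isPreconnected (z₀ := (t : ℂ)) (by simpa using ht) ?_
  have h' : ∃ᶠ x : ℝ in 𝓝[≠] t, f x = g x := h.frequently
  rw [frequently_iff_seq_forall] at h' ⊢
  obtain ⟨xs, hx, hxe⟩ := h'
  refine ⟨fun n => xs n, ?_, hxe⟩
  rw [tendsto_nhdsWithin_iff] at hx ⊢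
  refine ⟨(Complex.continuous_ofReal.tendsto t).comp hx.1, ?_⟩
  simpa using hx.2

lemma mem_slitPlane_one_sub {z : ℂ} (hz : z.re < 1) : 1 - z ∈ Complex.slitPlane :=
  Or.inl (by simpa using hz)

lemma analyticOnNhd_one_sub_cpow (c : ℂ) :
    AnalyticOnNhd ℂ (fun z : ℂ => (1 - z) ^ c) {z | z.re ∈ Set.Iio 1} := fun _ hz =>
  (analyticAt_const.sub analyticAt_id).cpow analyticAt_const (mem_slitPlane_one_sub hz)

/-- The formula is known for real arguments below `1`, and both sides are analytic on the half-plane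
`re z < 1`. -/
lemma complexMGF_stdGamma (a : ℝ≥0) {z : ℂ} (hz : z.re < 1) :
    complexMGF id (stdGamma a) z = (1 - z) ^ (-(a : ℂ)) := by
  have hsub : Set.Iio 1 ⊆ interior (integrableExpSet id (stdGamma a)) :=
    interior_maximal (fun c hc => (hasMgf_stdGamma a hc).1) isOpen_Iio
  refine eqOn_strip_of_eventuallyEq (convex_Iio 1) (f := complexMGF id (stdGamma a))
    (g := fun z => (1 - z) ^ (-(a : ℂ)))
    (fun w hw => analyticAt_complexMGF (hsub hw)) (analyticOnNhd_one_sub_cpow _)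
    (t := 0) (by simp) (nhdsWithin_le_nhds ?_) hz
  filter_upwards [Iio_mem_nhds (zero_lt_one (α := ℝ))] with x hx
  have h := (hasMgf_stdGamma a hx).2
  rw [complexMGF_ofReal]
  simp only [mgf, id]
  rw [h, Complex.ofReal_cpow (sub_nonneg.2 (le_of_lt hx))]
  push_cast
  rfl

/-- The characteristic function of the gamma law of shape `a`. -/
def gammaChar (a : ℝ≥0) (u : ℝ) : ℂ := (1 - u * Complex.I) ^ (-(a : ℂ))

lemma integral_exp_mul_I_stdGamma (a : ℝ≥0) (u : ℝ) :
    ∫ z : ℝ, Complex.exp (u * z * Complex.I) ∂(stdGamma a) = gammaChar a u := by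
  have h := complexMGF_stdGamma a (z := u * Complex.I) (by simp)
  rw [complexMGF] at h
  rw [gammaChar, ← h]
  refine integral_congr_ae (ae_of_all _ fun z => ?_)
  simp only [id]
  congr 1
  ring

lemma norm_gammaChar_sq (a : ℝ≥0) (u : ℝ) :
    ‖gammaChar a u‖ ^ 2 = Real.exp (-((a : ℝ) * Real.log (1 + u ^ 2))) := by
  have h0 : 0 < 1 + u ^ 2 := by positivity
  have h1 : ‖(1 - u * Complex.I : ℂ)‖ = (1 + u ^ 2) ^ (1 / 2 : ℝ) := by
    rw [← Real.sqrt_eq_rpow, Complex.norm_def, Complex.normSq_apply]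
    congr 1
    simp
    ring
  have h2 : (-(a : ℂ)) = ((-(a : ℝ) : ℝ) : ℂ) := by push_cast; rfl
  rw [gammaChar, h2, Complex.norm_cpow_real, h1, ← Real.rpow_mul h0.le, ← Real.rpow_natCast,
    ← Real.rpow_mul h0.le, Real.rpow_def_of_pos h0]
  congr 1
  push_cast
  ring

lemma one_sub_mul_I_mem_slitPlane (u : ℝ) : 1 - u * Complex.I ∈ Complex.slitPlane :=
  mem_slitPlane_one_sub (by simp)

lemma tendsto_gammaChar {ι : Type*} {l : Filter ι} {a : ι → ℝ≥0} {u : ι → ℝ} {a₀ : ℝ≥0} {u₀ : ℝ}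
    (ha : Tendsto a l (nhds a₀)) (hu : Tendsto u l (nhds u₀)) :
    Tendsto (fun p => gammaChar (a p) (u p)) l (nhds (gammaChar a₀ u₀)) := by
  refine Tendsto.cpow ?_ ?_ (one_sub_mul_I_mem_slitPlane u₀)
  · exact tendsto_const_nhds.sub (((Complex.continuous_ofReal.tendsto _).comp hu).mul_const _)
  · exact ((Complex.continuous_ofReal.tendsto _).comp
      ((NNReal.continuous_coe.tendsto _).comp ha)).neg

lemma continuous_gammaChar (a : ℝ≥0) : Continuous (gammaChar a) :=
  continuous_iff_continuousAt.2 fun _ => tendsto_gammaChar tendsto_const_nhds tendsto_id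

/-- The Fourier transform of a gamma convolution, with the normalization `e^{-2πi⟨x, ξ⟩}`. -/
def gammaConvFourier {d n : ℕ} (α : Fin n → ℝ≥0) (s : Matrix (Fin n) (Fin d) ℝ≥0)
    (ξ : Fin d → ℝ) : ℂ :=
  ∏ i, gammaChar (α i) (-(2 * Real.pi) * (scaleVec s i ⬝ᵥ ξ))

lemma continuous_gammaConvFourier {d n : ℕ} (α : Fin n → ℝ≥0)
    (s : Matrix (Fin n) (Fin d) ℝ≥0) : Continuous (gammaConvFourier α s) := by
  refine continuous_finsetProd _ fun i _ => (continuous_gammaChar _).comp ?_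
  simp only [dotProduct]
  fun_prop

/-- A gamma convolution, as a measure on Euclidean space. -/
def gammaConvEuclidean {d n : ℕ} (α : Fin n → ℝ≥0) (s : Matrix (Fin n) (Fin d) ℝ≥0) :
    Measure (EuclideanSpace ℝ (Fin d)) :=
  (gammaConv α s).map (MeasurableEquiv.toLp 2 (Fin d → ℝ))

instance {d n : ℕ} (α : Fin n → ℝ≥0) (s : Matrix (Fin n) (Fin d) ℝ≥0) :
    IsProbabilityMeasure (gammaConvEuclidean α s) :=
  Measure.isProbabilityMeasure_map (MeasurableEquiv.measurable _).aemeasurable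

lemma integral_exp_dotProduct_gammaConv {d n : ℕ} (α : Fin n → ℝ≥0)
    (s : Matrix (Fin n) (Fin d) ℝ≥0) (η : Fin d → ℝ) :
    ∫ x, Complex.exp ((x ⬝ᵥ η : ℝ) * Complex.I) ∂(gammaConv α s) =
      ∏ i, gammaChar (α i) (scaleVec s i ⬝ᵥ η) := by
  have hexp : ∀ z : Fin n → ℝ, Complex.exp ((mixScales s z ⬝ᵥ η : ℝ) * Complex.I)
      = ∏ i, Complex.exp ((scaleVec s i ⬝ᵥ η : ℝ) * z i * Complex.I) := by
    intro z
    rw [← Complex.exp_sum, mixScales_eq_sum, sum_dotProduct]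
    push_cast
    rw [Finset.sum_mul]
    congr 1
    refine Finset.sum_congr rfl fun i _ => ?_
    rw [smul_dotProduct, smul_eq_mul]
    push_cast
    ring
  have hm : Measurable fun x : Fin d → ℝ => Complex.exp ((x ⬝ᵥ η : ℝ) * Complex.I) := by
    simp only [dotProduct]
    fun_prop
  rw [gammaConv, integral_map (measurable_mixScales s).aemeasurable hm.aestronglyMeasurable]
  simp only [hexp]
  rw [integral_fintype_prod_eq_prod
    (fun i (z : ℝ) => Complex.exp ((scaleVec s i ⬝ᵥ η : ℝ) * z * Complex.I))]
  exact Finset.prod_congr rfl fun i _ => integral_exp_mul_I_stdGamma _ _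

lemma measureFourier_gammaConvEuclidean {d n : ℕ} (α : Fin n → ℝ≥0)
    (s : Matrix (Fin n) (Fin d) ℝ≥0) (ξ : EuclideanSpace ℝ (Fin d)) :
    measureFourier (gammaConvEuclidean α s) ξ = gammaConvFourier α s ξ.ofLp := by
  have h := integral_exp_dotProduct_gammaConv α s (-(2 * Real.pi) • ξ.ofLp)
  simp only [dotProduct_smul, smul_eq_mul] at h
  rw [gammaConvFourier, ← h, measureFourier, VectorFourier.fourierIntegral, gammaConvEuclidean,
    (MeasurableEquiv.measurableEmbedding _).integral_map]
  refine integral_congr_ae (ae_of_all _ fun x => ?_)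
  simp only [Circle.smul_def, Real.fourierChar_apply, innerₗ_apply_apply, smul_eq_mul, mul_one]
  congr 2
  simp [PiLp.inner_apply, dotProduct, mul_comm]

lemma memLp_measureFourier {d n : ℕ} {α : Fin n → ℝ≥0} {s : Matrix (Fin n) (Fin d) ℝ≥0}
    (h : MemLp (gammaConvFourier α s) 2 volume) :
    MemLp (measureFourier (gammaConvEuclidean α s)) 2 volume := by
  have h1 := h.comp_measurePreserving (PiLp.volume_preserving_ofLp (Fin d))
  exact (memLp_congr_ae (ae_of_all _ fun ξ => measureFourier_gammaConvEuclidean α s ξ)).2 h1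

lemma gammaConvDensity_eq {d n : ℕ} (α : Fin n → ℝ≥0) (s : Matrix (Fin n) (Fin d) ℝ≥0) :
    gammaConvDensity α s =ᵐ[volume] fun x =>
      ((gammaConvEuclidean α s).rnDeriv volume (WithLp.toLp 2 x)).toReal := by
  have h := (MeasurableEquiv.toLp 2 (Fin d → ℝ)).measurableEmbedding.rnDeriv_map
    (gammaConv α s) volume
  have hv : Measure.map (MeasurableEquiv.toLp 2 (Fin d → ℝ)) volume = volume :=
    (PiLp.volume_preserving_toLp (Fin d)).map_eq
  rw [hv] at h
  filter_upwards [h] with x hx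
  rw [gammaConvDensity, ← hx]
  rfl

/-- A gamma convolution with a square integrable Fourier transform has a density. -/
theorem gammaConv_absolutelyContinuous {d n : ℕ} {α : Fin n → ℝ≥0}
    {s : Matrix (Fin n) (Fin d) ℝ≥0} (h : MemLp (gammaConvFourier α s) 2 volume) :
    gammaConv α s ≪ volume := by
  have h1 := absolutelyContinuous_of_memLp_measureFourier _ (memLp_measureFourier h)
  have h2 := h1.map (MeasurableEquiv.toLp 2 (Fin d → ℝ)).symm.measurable
  rw [gammaConvEuclidean, Measure.map_map (MeasurableEquiv.measurable _)
    (MeasurableEquiv.measurable _), MeasurableEquiv.symm_comp_self, Measure.map_id] at h2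
  rwa [(EuclideanSpace.volume_preserving_symm_measurableEquiv_toLp (Fin d)).map_eq] at h2

/-- **Plancherel** for the densities of gamma convolutions. -/
theorem eLpNorm_gammaConvDensity_sub {d n : ℕ} {α β : Fin n → ℝ≥0}
    {s r : Matrix (Fin n) (Fin d) ℝ≥0} (hα : MemLp (gammaConvFourier α s) 2 volume)
    (hβ : MemLp (gammaConvFourier β r) 2 volume) :
    eLpNorm (gammaConvDensity α s - gammaConvDensity β r) 2 volume =
      eLpNorm (gammaConvFourier α s - gammaConvFourier β r) 2 volume := by
  have h := eLpNorm_density_sub _ _ (memLp_measureFourier hα) (memLp_measureFourier hβ)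
  have h1 : eLpNorm (gammaConvDensity α s - gammaConvDensity β r) 2 volume =
      eLpNorm (fun x => ((gammaConvEuclidean α s).rnDeriv volume x).toReal -
        ((gammaConvEuclidean β r).rnDeriv volume x).toReal) 2 volume := by
    rw [← eLpNorm_comp_measurePreserving _ (PiLp.volume_preserving_toLp (Fin d))]
    · exact eLpNorm_congr_ae ((gammaConvDensity_eq α s).sub (gammaConvDensity_eq β r))
    · exact ((Measure.measurable_rnDeriv _ _).ennreal_toReal.sub
        (Measure.measurable_rnDeriv _ _).ennreal_toReal).aestronglyMeasurable
  rw [h1, h, ← eLpNorm_comp_measurePreserving (((continuous_gammaConvFourier α s).sub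
    (continuous_gammaConvFourier β r)).aestronglyMeasurable)
    (PiLp.volume_preserving_ofLp (Fin d))]
  refine congrArg (fun f => eLpNorm f 2 volume) (funext fun ξ => ?_)
  simp [measureFourier_gammaConvEuclidean]

/-! ### Convergence of the Fourier transforms in `L²` -/

/-- Dominated convergence to `0` in which the dominating functions themselves converge. -/
lemma tendsto_lintegral_zero_of_le_of_tendsto {X : Type*} [MeasurableSpace X] {ν : Measure X}
    {f g : ℕ → X → ℝ≥0∞} {G : X → ℝ≥0∞} (hf : ∀ p, Measurable (f p)) (hg : ∀ p, Measurable (g p))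
    (hG : Measurable G) (hfg : ∀ᶠ p in atTop, ∀ x, f p x ≤ g p x)
    (hf0 : ∀ x, Tendsto (fun p => f p x) atTop (nhds 0))
    (hgG : ∀ x, Tendsto (fun p => g p x) atTop (nhds (G x))) (hGfin : ∫⁻ x, G x ∂ν ≠ ∞)
    (hint : Tendsto (fun p => ∫⁻ x, g p x ∂ν) atTop (nhds (∫⁻ x, G x ∂ν))) :
    Tendsto (fun p => ∫⁻ x, f p x ∂ν) atTop (nhds 0) := by
  -- Cutting at `G` gives `f p ≤ min (f p) G + (g p - min (g p) G)`. Both minima are dominated by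
  -- the fixed function `G`, and the integrals of `g p` and `min (g p) G` have the same limit.
  have h1 : Tendsto (fun p => ∫⁻ x, min (f p x) (G x) ∂ν) atTop (nhds 0) := by
    have := tendsto_lintegral_of_dominated_convergence (μ := ν) (F := fun p x => min (f p x) (G x))
      (f := fun _ => 0) G (fun p => (hf p).min hG)
      (fun p => ae_of_all _ fun x => min_le_right _ _) hGfin
      (ae_of_all _ fun x => by
        simpa using (hf0 x).min (tendsto_const_nhds (x := G x)))
    simpa using this
  have h2 : Tendsto (fun p => ∫⁻ x, min (g p x) (G x) ∂ν) atTop (nhds (∫⁻ x, G x ∂ν)) :=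
    tendsto_lintegral_of_dominated_convergence (μ := ν) (F := fun p x => min (g p x) (G x)) G
      (fun p => (hg p).min hG) (fun p => ae_of_all _ fun x => min_le_right _ _) hGfin
      (ae_of_all _ fun x => by
        simpa using (hgG x).min (tendsto_const_nhds (x := G x)))
  have h3 : Tendsto (fun p => ∫⁻ x, g p x ∂ν - ∫⁻ x, min (g p x) (G x) ∂ν) atTop (nhds 0) := by
    have := ENNReal.Tendsto.sub hint h2 (Or.inl hGfin)
    rwa [tsub_self] at this
  have h4 := h1.add h3
  rw [add_zero] at h4
  refine tendsto_of_tendsto_of_tendsto_of_le_of_le' tendsto_const_nhds h4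
    (Eventually.of_forall fun p => zero_le) ?_
  filter_upwards [hfg] with p hp
  have hmin : ∫⁻ x, min (g p x) (G x) ∂ν ≠ ∞ :=
    ((lintegral_mono fun x => min_le_right _ _).trans_lt (lt_top_iff_ne_top.2 hGfin)).ne
  rw [← lintegral_sub ((hg p).min hG) hmin (ae_of_all _ fun x => min_le_left _ _),
    ← lintegral_add_left ((hf p).min hG)]
  refine lintegral_mono fun x => ?_
  rcases le_total (f p x) (G x) with h | h
  · simp only [min_eq_left h]
    exact le_self_add
  · rw [min_eq_right h, min_eq_right (h.trans (hp x)), add_tsub_cancel_of_le (h.trans (hp x))]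
    exact hp x

/-- The product of Japanese brackets of the coordinates of `M ξ`. -/
def bracketProd {d : ℕ} (q : ℝ) (M : Matrix (Fin d) (Fin d) ℝ) (ξ : Fin d → ℝ) : ℝ :=
  ∏ k, ((1 : ℝ) + ‖(M.mulVec ξ) k‖ ^ 2) ^ (-q / 2)

lemma bracketProd_nonneg {d : ℕ} (q : ℝ) (M : Matrix (Fin d) (Fin d) ℝ) (ξ : Fin d → ℝ) :
    0 ≤ bracketProd q M ξ :=
  Finset.prod_nonneg fun k _ => Real.rpow_nonneg (by positivity) _

lemma tendsto_bracketProd {d : ℕ} (q : ℝ) {M : ℕ → Matrix (Fin d) (Fin d) ℝ}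
    {M₀ : Matrix (Fin d) (Fin d) ℝ} (hM : Tendsto M atTop (nhds M₀)) (ξ : Fin d → ℝ) :
    Tendsto (fun p => bracketProd q (M p) ξ) atTop (nhds (bracketProd q M₀ ξ)) := by
  refine tendsto_finsetProd _ fun k _ => Tendsto.rpow_const ?_ (Or.inl (by positivity))
  have h : Continuous fun M : Matrix (Fin d) (Fin d) ℝ => (1 : ℝ) + ‖(M.mulVec ξ) k‖ ^ 2 := by
    have : Continuous fun M : Matrix (Fin d) (Fin d) ℝ => M.mulVec ξ :=
      continuous_id.matrix_mulVec continuous_const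
    fun_prop
  exact (h.tendsto M₀).comp hM

lemma continuous_bracketProd {d : ℕ} (q : ℝ) (M : Matrix (Fin d) (Fin d) ℝ) :
    Continuous (bracketProd q M) := by
  have h : Continuous fun ξ : Fin d → ℝ => M.mulVec ξ :=
    continuous_const.matrix_mulVec continuous_id
  refine continuous_finsetProd _ fun k _ => Continuous.rpow_const (by fun_prop) fun ξ =>
    Or.inl (by positivity)

/-- A linear change of variables. The integral depends on `M` only through its determinant, hence
continuously while the determinant is nonzero. -/
lemma lintegral_bracketProd {d : ℕ} (q : ℝ) {M : Matrix (Fin d) (Fin d) ℝ} (hM : M.det ≠ 0) :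
    ∫⁻ ξ, ENNReal.ofReal (bracketProd q M ξ) =
      ENNReal.ofReal |M.det⁻¹| * ∫⁻ ξ, ENNReal.ofReal (bracketProd q (1 : Matrix (Fin d) (Fin d) ℝ)
        ξ) := by
  have h := Real.map_matrix_volume_pi_eq_smul_volume_pi hM
  have hm : Measurable (Matrix.toLin' M) :=
    (LinearMap.continuous_of_finiteDimensional _).measurable
  rw [← smul_eq_mul, ← lintegral_smul_measure, ← h, lintegral_map
    (continuous_bracketProd q 1).measurable.ennreal_ofReal hm]
  simp [bracketProd]

lemma lintegral_bracketProd_one_ne_top {d : ℕ} {q : ℝ} (hq : 1 < q) :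
    ∫⁻ ξ, ENNReal.ofReal (bracketProd q (1 : Matrix (Fin d) (Fin d) ℝ) ξ) ≠ ∞ := by
  have h : Integrable (fun x : ℝ => ((1 : ℝ) + ‖x‖ ^ 2) ^ (-q / 2)) :=
    integrable_rpow_neg_one_add_norm_sq (by simpa using hq)
  have h2 : Integrable (fun ξ : Fin d → ℝ => ∏ k, ((1 : ℝ) + ‖ξ k‖ ^ 2) ^ (-q / 2)) :=
    Integrable.fintype_prod fun _ => h
  simpa [bracketProd] using h2.lintegral_lt_top.ne

/-- The matrix of frequencies of `d` chosen scale vectors. -/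
def freqMatrix {d n : ℕ} (s : Matrix (Fin n) (Fin d) ℝ≥0) (B : Fin d → Fin n) :
    Matrix (Fin d) (Fin d) ℝ :=
  (-(2 * Real.pi)) • Matrix.of fun k => scaleVec s (B k)

lemma freqMatrix_mulVec {d n : ℕ} (s : Matrix (Fin n) (Fin d) ℝ≥0) (B : Fin d → Fin n)
    (ξ : Fin d → ℝ) (k : Fin d) :
    (freqMatrix s B).mulVec ξ k = -(2 * Real.pi) * (scaleVec s (B k) ⬝ᵥ ξ) := by
  rw [freqMatrix, Matrix.smul_mulVec]
  rfl

lemma det_freqMatrix_ne_zero {d n : ℕ} {s : Matrix (Fin n) (Fin d) ℝ≥0} {B : Fin d → Fin n}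
    (hB : LinearIndependent ℝ (scaleVec s ∘ B)) : (freqMatrix s B).det ≠ 0 := by
  rw [freqMatrix, Matrix.det_smul]
  refine mul_ne_zero (pow_ne_zero _ (by simp [Real.pi_ne_zero])) ?_
  have h : IsUnit (Matrix.of fun k => scaleVec s (B k)) :=
    Matrix.linearIndependent_rows_iff_isUnit.1 hB
  exact ((Matrix.isUnit_iff_isUnit_det _).1 h).ne_zero

open scoped Classical in
/-- The families of scale vectors that form a basis. -/
def scaleBases {d n : ℕ} (s : Matrix (Fin n) (Fin d) ℝ≥0) : Finset (Fin d → Fin n) :=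
  Finset.univ.filter fun B => LinearIndependent ℝ (scaleVec s ∘ B)

lemma mem_scaleBases {d n : ℕ} {s : Matrix (Fin n) (Fin d) ℝ≥0} {B : Fin d → Fin n} :
    B ∈ scaleBases s ↔ LinearIndependent ℝ (scaleVec s ∘ B) := by
  simp [scaleBases]

/-- If the shapes `β` nearly dominate shapes `α` that satisfy the codimension condition with respect
to `s`, then the Fourier transform of any gamma convolution with shapes `β` is bounded by products
of brackets over the bases for `s`. -/
lemma norm_gammaConvFourier_sq_le {d n : ℕ} {α : Fin n → ℝ≥0} {s : Matrix (Fin n) (Fin d) ℝ≥0}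
    {θ κ : ℝ} (hθ : 0 < θ) (hκ : 0 < κ)
    (hcodim : open scoped Classical in ∀ S : Set (Fin n),
      (d : ℝ) - Module.finrank ℝ (Submodule.span ℝ (scaleVec s '' S)) ≤
        θ * ∑ i, if scaleVec s i ∈ Submodule.span ℝ (scaleVec s '' S) then 0 else 2 * (α i : ℝ))
    (β : Fin n → ℝ≥0) (r : Matrix (Fin n) (Fin d) ℝ≥0) (hβ : ∀ i, κ * α i ≤ β i)
    (ξ : Fin d → ℝ) :
    ‖gammaConvFourier β r ξ‖ ^ 2 ≤
      ∑ B ∈ scaleBases s, bracketProd (κ / θ) (freqMatrix r B) ξ := by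
  set y : Fin n → ℝ := fun i => Real.log (1 + (-(2 * Real.pi) * (scaleVec r i ⬝ᵥ ξ)) ^ 2) with hy
  have hy0 : ∀ i, 0 ≤ y i := fun i => Real.log_nonneg (by
    have := sq_nonneg (-(2 * Real.pi) * (scaleVec r i ⬝ᵥ ξ))
    linarith)
  -- The squared modulus equals `exp (-∑ i, β i * y i)`, so `y` is the natural cost at `ξ`. The
  -- greedy basis depends on `ξ`, which is why the final bound sums over all bases.
  obtain ⟨B, hB, hle⟩ := exists_basis_sum_le (scaleVec s) (fun i => 2 * (α i : ℝ))
    (fun i => by positivity) hθ.le hcodim y hy0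
  have h1 : ‖gammaConvFourier β r ξ‖ ^ 2 = Real.exp (-∑ i, (β i : ℝ) * y i) := by
    rw [gammaConvFourier, norm_prod, ← Finset.prod_pow, ← Finset.sum_neg_distrib, Real.exp_sum]
    exact Finset.prod_congr rfl fun i _ => norm_gammaChar_sq _ _
  have h2 : bracketProd (κ / θ) (freqMatrix r B) ξ
      = Real.exp (-(κ / θ / 2 * ∑ k, y (B k))) := by
    rw [bracketProd, Finset.mul_sum, ← Finset.sum_neg_distrib, Real.exp_sum]
    refine Finset.prod_congr rfl fun k _ => ?_
    rw [Real.rpow_def_of_pos (by positivity), freqMatrix_mulVec, Real.norm_eq_abs, sq_abs]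
    congr 1
    simp only [hy]
    ring
  have h3 : κ / θ / 2 * ∑ k, y (B k) ≤ ∑ i, (β i : ℝ) * y i := by
    calc κ / θ / 2 * ∑ k, y (B k) ≤ κ / θ / 2 * (θ * ∑ i, 2 * (α i : ℝ) * y i) := by gcongr
      _ = ∑ i, κ * α i * y i := by
        rw [Finset.mul_sum, Finset.mul_sum]
        refine Finset.sum_congr rfl fun i _ => ?_
        field_simp
      _ ≤ _ := Finset.sum_le_sum fun i _ => mul_le_mul_of_nonneg_right (hβ i) (hy0 i)
  calc ‖gammaConvFourier β r ξ‖ ^ 2 ≤ bracketProd (κ / θ) (freqMatrix r B) ξ := by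
        rw [h1, h2]
        exact Real.exp_le_exp.2 (neg_le_neg h3)
    _ ≤ _ := Finset.single_le_sum (f := fun B => bracketProd (κ / θ) (freqMatrix r B) ξ)
        (fun B _ => bracketProd_nonneg _ _ _) (mem_scaleBases.2 hB)

open scoped Classical in
/-- The codimension condition holds with some margin. -/
lemma exists_codim_le {d n : ℕ} (α : Fin n → ℝ≥0) (s : Matrix (Fin n) (Fin d) ℝ≥0)
    (hdens : gammaConv α s ≪ volume) (hL2 : MemLp (gammaConvDensity α s) 2 volume) :
    ∃ θ : ℝ, 0 < θ ∧ θ < 1 ∧ ∀ S : Set (Fin n),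
      (d : ℝ) - Module.finrank ℝ (Submodule.span ℝ (scaleVec s '' S)) ≤
        θ * ∑ i, if scaleVec s i ∈ Submodule.span ℝ (scaleVec s '' S) then 0
          else 2 * (α i : ℝ) := by
  -- Each strict inequality persists for `θ` slightly below `1`, and there are finitely many `S`.
  -- When `S` spans, both sides vanish.
  have hS : ∀ S : Set (Fin n), ∀ᶠ θ : ℝ in nhdsWithin 1 (Set.Iio 1),
      (d : ℝ) - Module.finrank ℝ (Submodule.span ℝ (scaleVec s '' S)) ≤
        θ * ∑ i, if scaleVec s i ∈ Submodule.span ℝ (scaleVec s '' S) then 0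
          else 2 * (α i : ℝ) := by
    intro S
    by_cases htop : Submodule.span ℝ (scaleVec s '' S) = ⊤
    · have hrank : Module.finrank ℝ (Submodule.span ℝ (scaleVec s '' S)) = d := by
        rw [htop, finrank_top]
        simp
      rw [hrank]
      simp [htop]
    · have h := codim_lt_of_memLp_density α s hdens hL2 _ htop
      have h2 : (2 * ∑ i, if scaleVec s i ∈ Submodule.span ℝ (scaleVec s '' S) then 0
          else (α i : ℝ)) = ∑ i, if scaleVec s i ∈ Submodule.span ℝ (scaleVec s '' S) then 0
          else 2 * (α i : ℝ) := by
        rw [Finset.mul_sum]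
        exact Finset.sum_congr rfl fun i _ => by split_ifs <;> simp
      rw [h2] at h
      refine nhdsWithin_le_nhds ?_
      have hc : Tendsto (fun θ : ℝ => θ * ∑ i, if scaleVec s i ∈ Submodule.span ℝ (scaleVec s '' S)
          then 0 else 2 * (α i : ℝ)) (nhds 1) (nhds (1 * ∑ i, if scaleVec s i ∈
          Submodule.span ℝ (scaleVec s '' S) then 0 else 2 * (α i : ℝ))) :=
        tendsto_id.mul_const _
      rw [one_mul] at hc
      exact (hc.eventually_const_lt h).mono fun θ hθ => hθ.le
  have hpos : ∀ᶠ θ : ℝ in nhdsWithin 1 (Set.Iio 1), 0 < θ :=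
    nhdsWithin_le_nhds (Ioi_mem_nhds one_pos)
  obtain ⟨θ, h1, h2, h3⟩ :=
    ((eventually_all.2 hS).and (hpos.and self_mem_nhdsWithin)).exists
  exact ⟨θ, h2, h3, h1⟩

lemma ae_nonneg_stdGamma (a : ℝ≥0) : ∀ᵐ z ∂(stdGamma a), 0 ≤ z := by
  by_cases h : a = 0
  · subst h
    simp [stdGamma, ae_dirac_eq]
  · simp only [stdGamma, if_neg h, gammaMeasure]
    have hm : Measurable (gammaPDF a 1) := (measurable_gammaPDFReal a 1).ennreal_ofReal
    rw [ae_withDensity_iff hm]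
    refine ae_of_all _ fun z hz => ?_
    by_contra hneg
    exact hz (gammaPDF_of_neg (not_le.1 hneg))

/-- The left side is at most both `K * (x * z)` and `2`, while `1 - exp (-x * z)` is at least `x * z
/ 2` when `x * z ≤ 1` and at least `1 / 2` otherwise. -/
lemma norm_exp_mul_I_sub_one_le {u x K z : ℝ} (hx : 0 ≤ x) (hK : 0 ≤ K) (hu : |u| ≤ K * x)
    (hz : 0 ≤ z) :
    ‖Complex.exp (u * z * Complex.I) - 1‖ ≤ (2 * K + 4) * (1 - Real.exp (-x * z)) := by
  have hv : 0 ≤ x * z := mul_nonneg hx hz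
  have h1 : ‖Complex.exp (u * z * Complex.I) - 1‖ ≤ K * (x * z) := by
    have h := Real.norm_exp_I_mul_ofReal_sub_one_le (x := u * z)
    rw [mul_comm Complex.I, Complex.ofReal_mul, Real.norm_eq_abs, abs_mul, abs_of_nonneg hz] at h
    refine h.trans ?_
    rw [← mul_assoc]
    exact mul_le_mul_of_nonneg_right hu hz
  have h2 : ‖Complex.exp (u * z * Complex.I) - 1‖ ≤ 2 := by
    refine (norm_sub_le _ _).trans ?_
    rw [← Complex.ofReal_mul, Complex.norm_exp_ofReal_mul_I, norm_one]
    norm_num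
  have h3 : Real.exp (-x * z) ≤ (1 + x * z)⁻¹ := by
    rw [neg_mul, Real.exp_neg]
    exact inv_anti₀ (by positivity) (by linarith [Real.add_one_le_exp (x * z)])
  rcases le_total (x * z) 1 with hle | hge
  · have h4 : (1 + x * z)⁻¹ ≤ 1 - x * z / 2 := by
      rw [inv_le_iff_one_le_mul₀ (by positivity)]
      nlinarith
    nlinarith
  · have h4 : (1 + x * z)⁻¹ ≤ 1 / 2 := by
      rw [inv_le_iff_one_le_mul₀ (by positivity)]
      linarith
    nlinarith

/-- Integrating the pointwise bound compares the characteristic function with the Laplace transform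
`(1 + x) ^ (-a)`. The factor is thus controlled through `a * log (1 + x)` alone, which handles
components whose shape or scale diverges. -/
lemma norm_gammaChar_sub_one_le (a : ℝ≥0) {u x K : ℝ} (hx : 0 ≤ x) (hK : 0 ≤ K)
    (hu : |u| ≤ K * x) :
    ‖gammaChar a u - 1‖ ≤ (2 * K + 4) * (1 - Real.exp (-((a : ℝ) * Real.log (1 + x)))) := by
  have hmgf := hasMgf_stdGamma a (c := -x) (by linarith)
  have hexp : Real.exp (-((a : ℝ) * Real.log (1 + x))) =
      ∫ z, Real.exp (-x * z) ∂(stdGamma a) := by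
    rw [hmgf.2, sub_neg_eq_add, Real.rpow_def_of_pos (by positivity)]
    congr 1
    ring
  have hm : Measurable fun z : ℝ => Complex.exp (u * z * Complex.I) := by fun_prop
  have hint : Integrable (fun z : ℝ => Complex.exp (u * z * Complex.I)) (stdGamma a) := by
    refine (integrable_const (1 : ℝ)).mono' hm.aestronglyMeasurable (ae_of_all _ fun z => ?_)
    rw [← Complex.ofReal_mul, Complex.norm_exp_ofReal_mul_I]
  have h1 : gammaChar a u - 1 = ∫ z : ℝ, (Complex.exp (u * z * Complex.I) - 1) ∂(stdGamma a) := by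
    rw [integral_sub hint (integrable_const _), integral_exp_mul_I_stdGamma]
    simp
  have h2 : (2 * K + 4) * (1 - Real.exp (-((a : ℝ) * Real.log (1 + x)))) =
      ∫ z, (2 * K + 4) * (1 - Real.exp (-x * z)) ∂(stdGamma a) := by
    rw [integral_const_mul, integral_sub (integrable_const _) hmgf.1, hexp]
    simp
  rw [h1, h2]
  refine norm_integral_le_of_norm_le (((integrable_const _).sub hmgf.1).const_mul _) ?_
  filter_upwards [ae_nonneg_stdGamma a] with z hz
  exact norm_exp_mul_I_sub_one_le hx hK hu hz

/-- The sum of the products of brackets over the bases for `s`, with frequencies given by `r`. -/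
def bracketSum {d n : ℕ} (q : ℝ) (s r : Matrix (Fin n) (Fin d) ℝ≥0) (ξ : Fin d → ℝ) : ℝ≥0∞ :=
  ∑ B ∈ scaleBases s, ENNReal.ofReal (bracketProd q (freqMatrix r B) ξ)

/-- The parameters `β p, r p` converge to `α, s`, up to components that become negligible. -/
structure ParamsConverge {d n : ℕ} (β : ℕ → Fin n → ℝ≥0) (r : ℕ → Matrix (Fin n) (Fin d) ℝ≥0)
    (α : Fin n → ℝ≥0) (s : Matrix (Fin n) (Fin d) ℝ≥0) (good : Set (Fin n)) : Prop where
  shape : ∀ i ∈ good, Tendsto (fun p => β p i) atTop (nhds (α i))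
  scale : ∀ i ∈ good, ∀ j, Tendsto (fun p => r p i j) atTop (nhds (s i j))
  shape_eq_zero : ∀ i ∉ good, α i = 0
  scale_eq_zero : ∀ i ∉ good, ∀ j, s i j = 0
  negligible : ∀ i ∉ good,
    Tendsto (fun p => (β p i : ℝ) * Real.log (1 + ∑ j, (r p i j : ℝ))) atTop (nhds 0)

namespace ParamsConverge

variable {d n : ℕ} {β : ℕ → Fin n → ℝ≥0} {r : ℕ → Matrix (Fin n) (Fin d) ℝ≥0}
  {α : Fin n → ℝ≥0} {s : Matrix (Fin n) (Fin d) ℝ≥0} {good : Set (Fin n)}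

lemma tendsto_gammaConvFourier (h : ParamsConverge β r α s good) (ξ : Fin d → ℝ) :
    Tendsto (fun p => gammaConvFourier (β p) (r p) ξ) atTop (nhds (gammaConvFourier α s ξ)) := by
  refine tendsto_finsetProd _ fun i _ => ?_
  by_cases hi : i ∈ good
  · refine tendsto_gammaChar (h.shape i hi) (Tendsto.const_mul _ ?_)
    refine tendsto_finsetSum _ fun j _ => Tendsto.mul_const _ ?_
    exact (NNReal.continuous_coe.tendsto _).comp (h.scale i hi j)
  · have h0 : gammaChar (α i) (-(2 * Real.pi) * (scaleVec s i ⬝ᵥ ξ)) = 1 := by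
      simp [gammaChar, h.shape_eq_zero i hi]
    rw [h0, tendsto_iff_norm_sub_tendsto_zero]
    set K : ℝ := 2 * Real.pi * ∑ j, |ξ j| with hK
    have hK0 : 0 ≤ K := by positivity
    have hbound : ∀ p, ‖gammaChar (β p i) (-(2 * Real.pi) * (scaleVec (r p) i ⬝ᵥ ξ)) - 1‖ ≤
        (2 * K + 4) *
          (1 - Real.exp (-((β p i : ℝ) * Real.log (1 + ∑ j, (r p i j : ℝ))))) := by
      intro p
      refine norm_gammaChar_sub_one_le _ (by positivity) hK0 ?_
      rw [abs_mul, abs_neg, abs_of_pos Real.two_pi_pos, hK, mul_assoc (2 * Real.pi)]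
      refine mul_le_mul_of_nonneg_left ?_ Real.two_pi_pos.le
      refine (Finset.abs_sum_le_sum_abs _ _).trans ?_
      rw [Finset.mul_sum]
      refine Finset.sum_le_sum fun j _ => ?_
      have habs : |scaleVec (r p) i j| = (r p i j : ℝ) := NNReal.abs_eq _
      rw [abs_mul, habs, mul_comm]
      exact mul_le_mul_of_nonneg_right (Finset.single_le_sum (f := fun j => |ξ j|)
        (fun j _ => abs_nonneg _) (Finset.mem_univ j)) (r p i j).2
    have hlim : Tendsto (fun p => (2 * K + 4) *
        (1 - Real.exp (-((β p i : ℝ) * Real.log (1 + ∑ j, (r p i j : ℝ)))))) atTop (nhds 0) := by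
      have h1 := (((Real.continuous_exp.tendsto _).comp (h.negligible i hi).neg).const_sub
        1).const_mul (2 * K + 4)
      simpa using h1
    exact squeeze_zero (fun _ => norm_nonneg _) hbound hlim

/-- The limit scales of negligible components are `0`, so these components cannot occur in a basis
and only convergent rows appear. -/
lemma tendsto_freqMatrix (h : ParamsConverge β r α s good) {B : Fin d → Fin n}
    (hB : LinearIndependent ℝ (scaleVec s ∘ B)) :
    Tendsto (fun p => freqMatrix (r p) B) atTop (nhds (freqMatrix s B)) := by
  have hgood : ∀ k, B k ∈ good := by
    intro k
    by_contra hk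
    have h0 : scaleVec s (B k) = 0 := funext fun j => by simp [scaleVec, h.scale_eq_zero _ hk j]
    exact hB.ne_zero k h0
  refine Tendsto.const_smul ?_ _
  refine tendsto_pi_nhds.2 fun k => tendsto_pi_nhds.2 fun j => ?_
  exact (NNReal.continuous_coe.tendsto _).comp (h.scale _ (hgood k) j)

lemma eventually_shape_le (h : ParamsConverge β r α s good) {κ : ℝ} (hκ : κ < 1) :
    ∀ᶠ p in atTop, ∀ i, κ * α i ≤ β p i := by
  refine eventually_all.2 fun i => ?_
  by_cases hi : i ∈ good
  · by_cases h0 : α i = 0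
    · simp [h0]
    · have hpos : (0 : ℝ) < α i := by positivity
      have hlt : κ * α i < α i := by nlinarith
      exact (((NNReal.continuous_coe.tendsto _).comp (h.shape i hi)).eventually_const_lt
        hlt).mono fun p hp => hp.le
  · simp [h.shape_eq_zero i hi]

/-- Convergence of the parameters implies `L²` convergence of the densities, if the limit has a
square integrable density. -/
theorem tendsto_eLpNorm (h : ParamsConverge β r α s good) (hdens : gammaConv α s ≪ volume)
    (hL2 : MemLp (gammaConvDensity α s) 2 volume) :
    (∀ᶠ p in atTop, gammaConv (β p) (r p) ≪ volume) ∧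
      Tendsto (fun p => eLpNorm (gammaConvDensity α s - gammaConvDensity (β p) (r p)) 2 volume)
        atTop (nhds 0) := by
  obtain ⟨θ, hθ0, hθ1, hcodim⟩ := exists_codim_le α s hdens hL2
  -- The margin is split in two: `κ < 1` absorbs the perturbation of the shapes, and `κ / θ > 1`
  -- makes the brackets integrable.
  obtain ⟨κ, hθκ, hκ1⟩ := exists_between hθ1
  have hκ0 : 0 < κ := hθ0.trans hθκ
  have hq : 1 < κ / θ := (one_lt_div hθ0).2 hθκ
  set q := κ / θ with hqdef
  have hbound : ∀ (β' : Fin n → ℝ≥0) (r' : Matrix (Fin n) (Fin d) ℝ≥0),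
      (∀ i, κ * α i ≤ β' i) → ∀ ξ, ‖gammaConvFourier β' r' ξ‖ₑ ^ 2 ≤
        bracketSum q s r' ξ := by
    intro β' r' hβ' ξ
    rw [bracketSum, ← ENNReal.ofReal_sum_of_nonneg fun B _ => bracketProd_nonneg _ _ _, ← ofReal_norm,
      ← ENNReal.ofReal_pow (norm_nonneg _)]
    exact ENNReal.ofReal_le_ofReal (norm_gammaConvFourier_sq_le hθ0 hκ0 hcodim β' r' hβ' ξ)
  have hmeas : ∀ (r' : Matrix (Fin n) (Fin d) ℝ≥0), Measurable (bracketSum q s r') := fun r' =>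
    Finset.measurable_sum _ fun B _ => (continuous_bracketProd q _).measurable.ennreal_ofReal
  set c₀ := ∫⁻ ξ, ENNReal.ofReal (bracketProd q (1 : Matrix (Fin d) (Fin d) ℝ) ξ) with hc₀
  have hc₀top : c₀ ≠ ∞ := lintegral_bracketProd_one_ne_top hq
  have hlint : ∀ (r' : Matrix (Fin n) (Fin d) ℝ≥0), (∀ B ∈ scaleBases s, (freqMatrix r' B).det ≠ 0) →
      ∫⁻ ξ, bracketSum q s r' ξ =
        ∑ B ∈ scaleBases s, ENNReal.ofReal |(freqMatrix r' B).det⁻¹| * c₀ := by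
    intro r' hr'
    simp only [bracketSum]
    rw [lintegral_finsetSum _ fun B _ =>
      (continuous_bracketProd q _).measurable.ennreal_ofReal]
    exact Finset.sum_congr rfl fun B hB => lintegral_bracketProd q (hr' B hB)
  have hfin : ∀ (r' : Matrix (Fin n) (Fin d) ℝ≥0), (∀ B ∈ scaleBases s, (freqMatrix r' B).det ≠ 0) →
      ∫⁻ ξ, bracketSum q s r' ξ ≠ ∞ := by
    intro r' hr'
    rw [hlint r' hr']
    exact (ENNReal.sum_lt_top.2 fun B _ =>
      ENNReal.mul_lt_top ENNReal.ofReal_lt_top (lt_top_iff_ne_top.2 hc₀top)).ne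
  have hmemLp : ∀ (β' : Fin n → ℝ≥0) (r' : Matrix (Fin n) (Fin d) ℝ≥0),
      (∀ i, κ * α i ≤ β' i) → (∀ B ∈ scaleBases s, (freqMatrix r' B).det ≠ 0) →
      MemLp (gammaConvFourier β' r') 2 volume := by
    intro β' r' hβ' hr'
    refine ⟨(continuous_gammaConvFourier β' r').aestronglyMeasurable, ?_⟩
    rw [eLpNorm_lt_top_iff_lintegral_rpow_enorm_lt_top (by norm_num) (by norm_num)]
    refine lt_of_le_of_lt (lintegral_mono fun ξ => ?_) (lt_top_iff_ne_top.2 (hfin r' hr'))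
    simpa using hbound β' r' hβ' ξ
  have hdet₀ : ∀ B ∈ scaleBases s, (freqMatrix s B).det ≠ 0 := fun B hB =>
    det_freqMatrix_ne_zero (mem_scaleBases.1 hB)
  have htdet : ∀ B ∈ scaleBases s,
      Tendsto (fun p => (freqMatrix (r p) B).det) atTop (nhds (freqMatrix s B).det) := fun B hB =>
    ((continuous_id.matrix_det).tendsto _).comp (h.tendsto_freqMatrix (mem_scaleBases.1 hB))
  have hdet : ∀ᶠ p in atTop, ∀ B ∈ scaleBases s, (freqMatrix (r p) B).det ≠ 0 :=
    (Finset.eventually_all _).2 fun B hB => (htdet B hB).eventually_ne (hdet₀ B hB)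
  have hshape := h.eventually_shape_le hκ1
  have hα : ∀ i, κ * α i ≤ α i := fun i => mul_le_of_le_one_left (α i).2 hκ1.le
  have hF₀ := hmemLp α s hα hdet₀
  have hF : ∀ᶠ p in atTop, MemLp (gammaConvFourier (β p) (r p)) 2 volume := by
    filter_upwards [hshape, hdet] with p h1 h2 using hmemLp _ _ h1 h2
  refine ⟨hF.mono fun p hp => gammaConv_absolutelyContinuous hp, ?_⟩
  have hmain : Tendsto (fun p => ∫⁻ ξ, ‖gammaConvFourier α s ξ -
      gammaConvFourier (β p) (r p) ξ‖ₑ ^ 2) atTop (nhds 0) := by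
    have hadd : ∀ r', Measurable fun ξ => bracketSum q s s ξ + bracketSum q s r' ξ := fun r' =>
      (hmeas s).add (hmeas r')
    -- The dominating function uses the frequencies of `r p` and moves with `p`; its integral
    -- converges because the determinants of the frequency matrices do.
    refine tendsto_lintegral_zero_of_le_of_tendsto
      (g := fun p ξ => 2 * (bracketSum q s s ξ +
        bracketSum q s (r p) ξ))
      (G := fun ξ => 2 * (bracketSum q s s ξ + bracketSum q s s ξ)) ?_ ?_ ?_ ?_ ?_ ?_ ?_ ?_
    · exact fun p => (((continuous_gammaConvFourier α s).sub
        (continuous_gammaConvFourier _ _)).enorm.measurable).pow_const 2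
    · exact fun p => (hadd (r p)).const_mul 2
    · exact (hadd s).const_mul 2
    · filter_upwards [hshape] with p hp ξ
      refine le_trans ?_ (mul_le_mul_right (add_le_add (hbound α s hα ξ) (hbound _ (r p) hp ξ)) 2)
      refine (pow_le_pow_left' (enorm_sub_le) 2).trans ?_
      have := ENNReal.rpow_add_le_mul_rpow_add_rpow ‖gammaConvFourier α s ξ‖ₑ
        ‖gammaConvFourier (β p) (r p) ξ‖ₑ (p := 2) one_le_two
      norm_num at this
      simpa using this
    · intro ξ
      have h1 := (h.tendsto_gammaConvFourier ξ).const_sub (gammaConvFourier α s ξ)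
      rw [sub_self] at h1
      have h2 := ((ENNReal.continuous_pow 2).tendsto _).comp h1.enorm
      simpa [Function.comp_def] using h2
    · intro ξ
      refine ENNReal.Tendsto.const_mul (Tendsto.add tendsto_const_nhds ?_) (Or.inr (by norm_num))
      exact tendsto_finsetSum _ fun B hB => ENNReal.tendsto_ofReal
        (tendsto_bracketProd q (h.tendsto_freqMatrix (mem_scaleBases.1 hB)) ξ)
    · rw [lintegral_const_mul _ (hadd _), lintegral_add_left (hmeas s)]
      have := hfin s hdet₀
      finiteness
    · simp_rw [lintegral_const_mul _ (hadd _), lintegral_add_left (hmeas s)]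
      refine ENNReal.Tendsto.const_mul (Tendsto.add tendsto_const_nhds ?_) (Or.inr (by norm_num))
      rw [hlint s hdet₀]
      have hsum : Tendsto (fun p => ∑ B ∈ scaleBases s,
          ENNReal.ofReal |(freqMatrix (r p) B).det⁻¹| * c₀) atTop
          (nhds (∑ B ∈ scaleBases s, ENNReal.ofReal |(freqMatrix s B).det⁻¹| * c₀)) :=
        tendsto_finsetSum _ fun B hB => ENNReal.Tendsto.mul_const (ENNReal.tendsto_ofReal
          ((htdet B hB).inv₀ (hdet₀ B hB)).abs) (Or.inr hc₀top)
      refine hsum.congr' ?_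
      filter_upwards [hdet] with p hp using (hlint (r p) hp).symm
  have hroot := ((ENNReal.continuous_rpow_const (y := 1 / 2)).tendsto _).comp hmain
  rw [ENNReal.zero_rpow_of_pos (by norm_num)] at hroot
  refine hroot.congr' ?_
  filter_upwards [hF] with p hp
  rw [eLpNorm_gammaConvDensity_sub hF₀ hp,
    eLpNorm_eq_lintegral_rpow_enorm_toReal (by norm_num) (by norm_num)]
  simp

end ParamsConverge

/-! ### Laguerre coefficients determine Laplace transforms -/

/-- The function `e^{-x} x^k` on `[0, ∞)`, extended by `0`. -/
def expPow (k : ℕ) (x : ℝ) : ℝ := if 0 ≤ x then Real.exp (-x) * x ^ k else 0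

lemma measurable_expPow (k : ℕ) : Measurable (expPow k) :=
  Measurable.ite measurableSet_Ici (by fun_prop) measurable_const

lemma abs_expPow_le (k : ℕ) (x : ℝ) : |expPow k x| ≤ k.factorial := by
  unfold expPow
  split_ifs with hx
  · rw [abs_of_nonneg (by positivity)]
    have h := Real.pow_div_factorial_le_exp x hx k
    rw [div_le_iff₀ (by positivity)] at h
    calc Real.exp (-x) * x ^ k ≤ Real.exp (-x) * (Real.exp x * k.factorial) := by gcongr
      _ = k.factorial := by rw [← mul_assoc, ← Real.exp_add]; simp
  · simp

lemma expPow_succ (k : ℕ) (x : ℝ) : expPow (k + 1) x = expPow k x * x := by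
  unfold expPow
  split_ifs <;> ring

lemma laguerreFun_eq_sum (k : ℕ) : laguerreFun k = ∑ l ∈ Finset.range (k + 1),
    (√2 * k.choose l * (-2) ^ l / l.factorial) • expPow l := by
  funext x
  simp only [Finset.sum_apply, Pi.smul_apply, smul_eq_mul, laguerreFun, expPow]
  split_ifs
  · rw [Finset.mul_sum]
    refine Finset.sum_congr rfl fun l _ => ?_
    rw [mul_pow]
    ring
  · simp

lemma measurable_laguerreFun (k : ℕ) : Measurable (laguerreFun k) := by
  rw [laguerreFun_eq_sum, Finset.sum_fn]
  refine Finset.measurable_sum _ fun l _ => ?_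
  exact (measurable_expPow l).const_smul (√2 * k.choose l * (-2) ^ l / l.factorial)

lemma exists_abs_laguerreFun_le (k : ℕ) : ∃ C, ∀ x, |laguerreFun k x| ≤ C := by
  refine ⟨∑ l ∈ Finset.range (k + 1),
    |√2 * k.choose l * (-2) ^ l / l.factorial| * l.factorial, fun x => ?_⟩
  rw [laguerreFun_eq_sum, Finset.sum_apply]
  refine (Finset.abs_sum_le_sum_abs _ _).trans (Finset.sum_le_sum fun l _ => ?_)
  rw [Pi.smul_apply, smul_eq_mul, abs_mul]
  exact mul_le_mul_of_nonneg_left (abs_expPow_le l x) (abs_nonneg _)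

/-- The expansion of `laguerreFun k` in the functions `expPow l` is triangular with nonzero leading
coefficient, so it can be inverted. -/
lemma expPow_mem_span (k : ℕ) : expPow k ∈ Submodule.span ℝ (Set.range laguerreFun) := by
  induction k using Nat.strong_induction_on with
  | _ k ih =>
    have h := laguerreFun_eq_sum k
    rw [Finset.sum_range_succ] at h
    set c : ℝ := √2 * k.choose k * (-2) ^ k / k.factorial with hc
    have hc0 : c ≠ 0 := by
      rw [hc, Nat.choose_self]
      have : (k.factorial : ℝ) ≠ 0 := by positivity
      simp [this]
    have h2 : expPow k = c⁻¹ • (laguerreFun k - ∑ l ∈ Finset.range k,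
        (√2 * k.choose l * (-2) ^ l / l.factorial) • expPow l) := by
      rw [h, add_sub_cancel_left, smul_smul, inv_mul_cancel₀ hc0, one_smul]
    rw [h2]
    refine Submodule.smul_mem _ _ (Submodule.sub_mem _ (Submodule.subset_span ⟨k, rfl⟩)
      (Submodule.sum_mem _ fun l hl => Submodule.smul_mem _ _ (ih l (Finset.mem_range.1 hl))))

/-- The function `e^{-∑ x j} ∏ (x j)^(k j)` on `[0, ∞)^d`, extended by `0`. -/
def expMon {d : ℕ} (k : Fin d → ℕ) (x : Fin d → ℝ) : ℝ := ∏ j, expPow (k j) (x j)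

lemma expMon_mem_span {d : ℕ} (k : Fin d → ℕ) :
    expMon k ∈ Submodule.span ℝ (Set.range (laguerre (d := d))) := by
  choose c hc using fun k => Finsupp.mem_span_range_iff_exists_finsupp.1 (expPow_mem_span k)
  have h : expMon k = ∑ f ∈ Fintype.piFinset fun j => (c (k j)).support,
      (∏ j, c (k j) (f j)) • laguerre f := by
    funext x
    have h1 : ∀ j, expPow (k j) (x j) =
        ∑ l ∈ (c (k j)).support, c (k j) l * laguerreFun l (x j) := by
      intro j
      conv_lhs => rw [← hc (k j)]
      simp [Finsupp.sum, Finset.sum_apply]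
    simp only [expMon, h1, Finset.prod_univ_sum, Finset.sum_apply, Pi.smul_apply, smul_eq_mul,
      laguerre, Finset.prod_mul_distrib]
  rw [h]
  exact Submodule.sum_mem _ fun f _ => Submodule.smul_mem _ _ (Submodule.subset_span ⟨f, rfl⟩)

lemma mul_coord_mem_span {d : ℕ} (j : Fin d) {g : (Fin d → ℝ) → ℝ}
    (hg : g ∈ Submodule.span ℝ (Set.range (expMon (d := d)))) :
    (fun x => g x * x j) ∈ Submodule.span ℝ (Set.range (expMon (d := d))) := by
  induction hg using Submodule.span_induction with
  | mem g hg =>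
    obtain ⟨k, rfl⟩ := hg
    refine Submodule.subset_span ⟨k + Pi.single j 1, funext fun x => ?_⟩
    have h : ∀ i, expPow ((k + Pi.single j 1 : Fin d → ℕ) i) (x i) =
        expPow (k i) (x i) * if i = j then x i else 1 := by
      intro i
      by_cases hi : i = j
      · subst hi
        simp [expPow_succ]
      · simp [hi]
    simp only [expMon, h, Finset.prod_mul_distrib, Finset.prod_ite_eq', Finset.mem_univ, if_true]
  | zero =>
    simp only [Pi.zero_apply, zero_mul]
    exact Submodule.zero_mem _
  | add g g' _ _ h h' =>
    convert Submodule.add_mem _ h h' using 1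
    funext x
    simp [add_mul]
  | smul a g _ h =>
    convert Submodule.smul_mem _ a h using 1
    funext x
    simp [mul_assoc]

/-- Up to factorials, with `w = 1 - t`, these are the terms of the series for `e^{-⟨t, x⟩}` used
below. Multiplication by a linear form preserves the span of the exponential monomials. -/
lemma expMon_zero_mul_pow_mem_span {d : ℕ} (w : Fin d → ℝ) (p : ℕ) :
    (fun x => expMon 0 x * (w ⬝ᵥ x) ^ p) ∈
      Submodule.span ℝ (Set.range (laguerre (d := d))) := by
  have h : (fun x => expMon 0 x * (w ⬝ᵥ x) ^ p) ∈
      Submodule.span ℝ (Set.range (expMon (d := d))) := by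
    induction p with
    | zero =>
      simp only [pow_zero, mul_one]
      exact Submodule.subset_span ⟨0, rfl⟩
    | succ p ih =>
      have h1 : (fun x => expMon 0 x * (w ⬝ᵥ x) ^ (p + 1)) =
          ∑ j, w j • fun x => (expMon 0 x * (w ⬝ᵥ x) ^ p) * x j := by
        funext x
        simp only [Finset.sum_apply, Pi.smul_apply, smul_eq_mul]
        rw [pow_succ, ← mul_assoc]
        conv_lhs => rw [dotProduct.eq_def, Finset.mul_sum]
        exact Finset.sum_congr rfl fun j _ => by rw [dotProduct.eq_def]; ring
      rw [h1]
      exact Submodule.sum_mem _ fun j _ => Submodule.smul_mem _ _ (mul_coord_mem_span j ih)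
  refine Submodule.span_le.2 ?_ h
  rintro _ ⟨k, rfl⟩
  exact expMon_mem_span k

lemma measurable_laguerre {d : ℕ} (k : Fin d → ℕ) : Measurable (laguerre k) :=
  Finset.measurable_prod _ fun j _ => (measurable_laguerreFun (k j)).comp (measurable_pi_apply j)

lemma integrable_laguerre {d : ℕ} (k : Fin d → ℕ) (μ : Measure (Fin d → ℝ)) [IsFiniteMeasure μ] :
    Integrable (laguerre k) μ := by
  choose C hC using exists_abs_laguerreFun_le
  refine (integrable_const (∏ j, C (k j))).mono' (measurable_laguerre k).aestronglyMeasurable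
    (ae_of_all _ fun x => ?_)
  rw [laguerre, norm_prod]
  exact Finset.prod_le_prod (fun j _ => norm_nonneg _) fun j _ => hC _ _

lemma integrable_of_mem_span_laguerre {d : ℕ} {g : (Fin d → ℝ) → ℝ}
    (hg : g ∈ Submodule.span ℝ (Set.range (laguerre (d := d)))) (μ : Measure (Fin d → ℝ))
    [IsFiniteMeasure μ] : Integrable g μ := by
  induction hg using Submodule.span_induction with
  | mem g hg =>
    obtain ⟨k, rfl⟩ := hg
    exact integrable_laguerre k μ
  | zero => exact integrable_zero _ _ _
  | add g g' _ _ h h' => exact h.add h'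
  | smul a g _ h => exact h.smul a

lemma tendsto_integral_of_mem_span_laguerre {d : ℕ} {μ : ℕ → Measure (Fin d → ℝ)}
    [∀ p, IsFiniteMeasure (μ p)] {ν : Measure (Fin d → ℝ)} [IsFiniteMeasure ν]
    (h : ∀ k, Tendsto (fun p => ∫ x, laguerre k x ∂(μ p)) atTop (nhds (∫ x, laguerre k x ∂ν)))
    {g : (Fin d → ℝ) → ℝ} (hg : g ∈ Submodule.span ℝ (Set.range (laguerre (d := d)))) :
    Tendsto (fun p => ∫ x, g x ∂(μ p)) atTop (nhds (∫ x, g x ∂ν)) := by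
  induction hg using Submodule.span_induction with
  | mem g hg =>
    obtain ⟨k, rfl⟩ := hg
    exact h k
  | zero => simp
  | add g g' hg hg' h h' =>
    have hi := integrable_of_mem_span_laguerre hg
    have hi' := integrable_of_mem_span_laguerre hg'
    simp only [Pi.add_apply]
    rw [integral_add (hi ν) (hi' ν)]
    exact (h.add h').congr fun p => (integral_add (hi _) (hi' _)).symm
  | smul a g _ h =>
    simp only [Pi.smul_apply, smul_eq_mul, integral_const_mul]
    exact h.const_mul a

/-- Factor the kernel as `e^{-∑ x j} * e^{⟨1 - t, x⟩}` and expand the second factor. -/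
lemma hasSum_exp_neg_dotProduct {d : ℕ} (t : Fin d → ℝ) {x : Fin d → ℝ} (hx : ∀ j, 0 ≤ x j) :
    HasSum (fun p : ℕ => expMon 0 x * ((1 - t) ⬝ᵥ x) ^ p / p.factorial) (Real.exp (-(t ⬝ᵥ x))) := by
  have h := (NormedSpace.expSeries_div_hasSum_exp ((1 - t) ⬝ᵥ x)).mul_left (expMon 0 x)
  rw [← Real.exp_eq_exp_ℝ] at h
  have h1 : expMon 0 x * Real.exp ((1 - t) ⬝ᵥ x) = Real.exp (-(t ⬝ᵥ x)) := by
    have h2 : expMon 0 x = Real.exp (-((1 : Fin d → ℝ) ⬝ᵥ x)) := by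
      simp only [expMon, expPow, hx, if_true, Pi.zero_apply, pow_zero, mul_one]
      rw [← Real.exp_sum]
      simp [dotProduct]
    rw [h2, ← Real.exp_add, sub_dotProduct]
    congr 1
    ring
  rw [h1] at h
  simpa only [mul_div_assoc] using h

/-- With `σ = ∑ j, x j` the term is at most `ρ ^ p * (e^{-σ} * σ ^ p / p!)`, and the bracket is at
most `1`. The bound does not depend on `x`, so it is uniform over probability measures on the
orthant. -/
lemma abs_expMon_zero_mul_pow_le {d : ℕ} {t : Fin d → ℝ} {ρ : ℝ} (hρ : ∀ j, |1 - t j| ≤ ρ)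
    (hρ0 : 0 ≤ ρ) {x : Fin d → ℝ} (hx : ∀ j, 0 ≤ x j) (p : ℕ) :
    |expMon 0 x * ((1 - t) ⬝ᵥ x) ^ p / p.factorial| ≤ ρ ^ p := by
  set σ := ∑ j, x j with hσ
  have hσ0 : 0 ≤ σ := Finset.sum_nonneg fun j _ => hx j
  have h1 : |(1 - t) ⬝ᵥ x| ≤ ρ * σ := by
    refine (Finset.abs_sum_le_sum_abs _ _).trans ?_
    rw [hσ, Finset.mul_sum]
    refine Finset.sum_le_sum fun j _ => ?_
    rw [abs_mul, abs_of_nonneg (hx j)]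
    exact mul_le_mul_of_nonneg_right (hρ j) (hx j)
  have h2 : expMon 0 x = Real.exp (-σ) := by
    simp only [expMon, expPow, hx, if_true, Pi.zero_apply, pow_zero, mul_one]
    rw [← Real.exp_sum, Finset.sum_neg_distrib]
  have h3 := abs_expPow_le p σ
  rw [expPow, if_pos hσ0, abs_of_nonneg (by positivity)] at h3
  rw [abs_div, abs_mul, abs_pow, h2, abs_of_pos (Real.exp_pos _), Nat.abs_cast,
    div_le_iff₀ (by positivity)]
  calc Real.exp (-σ) * |(1 - t) ⬝ᵥ x| ^ p ≤ Real.exp (-σ) * (ρ * σ) ^ p := by gcongr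
    _ = ρ ^ p * (Real.exp (-σ) * σ ^ p) := by ring
    _ ≤ ρ ^ p * p.factorial := by gcongr

lemma hasSum_integral_exp_neg_dotProduct {d : ℕ} (μ : Measure (Fin d → ℝ)) [IsFiniteMeasure μ]
    (hμ : ∀ᵐ x ∂μ, ∀ j, 0 ≤ x j) {t : Fin d → ℝ} {ρ : ℝ} (hρ : ∀ j, |1 - t j| ≤ ρ)
    (hρ0 : 0 ≤ ρ) (hρ1 : ρ < 1) :
    HasSum (fun p : ℕ => ∫ x, expMon 0 x * ((1 - t) ⬝ᵥ x) ^ p / p.factorial ∂μ)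
      (∫ x, Real.exp (-(t ⬝ᵥ x)) ∂μ) := by
  refine hasSum_integral_of_dominated_convergence (fun p _ => ρ ^ p) (fun p => ?_) (fun p => ?_)
    (ae_of_all _ fun _ => summable_geometric_of_lt_one hρ0 hρ1) (integrable_const _) ?_
  · exact ((integrable_of_mem_span_laguerre (expMon_zero_mul_pow_mem_span (1 - t) p)
      μ).div_const _).aestronglyMeasurable
  · filter_upwards [hμ] with x hx using abs_expMon_zero_mul_pow_le hρ hρ0 hx p
  · filter_upwards [hμ] with x hx using hasSum_exp_neg_dotProduct t hx

/-- If the Laguerre coefficients converge, then so do the Laplace transforms on `(0, 2)^d`. -/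
theorem tendsto_laplace_of_tendsto_laguerre {d : ℕ} {μ : ℕ → Measure (Fin d → ℝ)}
    [∀ p, IsProbabilityMeasure (μ p)] {ν : Measure (Fin d → ℝ)} [IsFiniteMeasure ν]
    (hμ : ∀ p, ∀ᵐ x ∂(μ p), ∀ j, 0 ≤ x j) (hν : ∀ᵐ x ∂ν, ∀ j, 0 ≤ x j)
    (h : ∀ k, Tendsto (fun p => ∫ x, laguerre k x ∂(μ p)) atTop (nhds (∫ x, laguerre k x ∂ν)))
    {t : Fin d → ℝ} (ht : ∀ j, t j ∈ Set.Ioo 0 2) :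
    Tendsto (fun p => ∫ x, Real.exp (-(t ⬝ᵥ x)) ∂(μ p)) atTop
      (nhds (∫ x, Real.exp (-(t ⬝ᵥ x)) ∂ν)) := by
  -- The box `(0, 2)^d` is exactly where every `|1 - t j| < 1`. A common `ρ < 1` gives a geometric
  -- bound that allows the limit to be taken term by term.
  obtain ⟨ρ, hρ, hρ0, hρ1⟩ : ∃ ρ : ℝ, (∀ j, |1 - t j| ≤ ρ) ∧ 0 < ρ ∧ ρ < 1 := by
    have h1 : ∀ j, ∀ᶠ ρ : ℝ in nhdsWithin 1 (Set.Iio 1), |1 - t j| ≤ ρ := fun j => by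
      have hlt : |1 - t j| < 1 := abs_lt.2 ⟨by linarith [(ht j).2], by linarith [(ht j).1]⟩
      have h0 : ∀ᶠ ρ : ℝ in nhdsWithin 1 (Set.Iio 1), |1 - t j| < ρ :=
        nhdsWithin_le_nhds (Ioi_mem_nhds hlt)
      exact h0.mono fun _ h => le_of_lt h
    have h2 : ∀ᶠ ρ : ℝ in nhdsWithin 1 (Set.Iio 1), 0 < ρ :=
      nhdsWithin_le_nhds (Ioi_mem_nhds one_pos)
    exact ((eventually_all.2 h1).and (h2.and self_mem_nhdsWithin)).exists
  rw [← (hasSum_integral_exp_neg_dotProduct ν hν hρ hρ0.le hρ1).tsum_eq]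
  simp_rw [← (hasSum_integral_exp_neg_dotProduct (μ _) (hμ _) hρ hρ0.le hρ1).tsum_eq]
  refine tendsto_tsum_of_dominated_convergence (bound := fun p => ρ ^ p)
    (summable_geometric_of_lt_one hρ0.le hρ1) (fun p => ?_) (Eventually.of_forall fun q p => ?_)
  · simp_rw [integral_div]
    exact (tendsto_integral_of_mem_span_laguerre h
      (expMon_zero_mul_pow_mem_span (1 - t) p)).div_const _
  · refine (norm_integral_le_of_norm_le_const (C := ρ ^ p) ?_).trans (by simp)
    filter_upwards [hμ q] with x hx using abs_expMon_zero_mul_pow_le hρ hρ0.le hx p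

/-! ### Laplace transforms of gamma convolutions -/

lemma ae_nonneg_gammaConv {d n : ℕ} (α : Fin n → ℝ≥0) (s : Matrix (Fin n) (Fin d) ℝ≥0) :
    ∀ᵐ x ∂(gammaConv α s), ∀ j, 0 ≤ x j := by
  have hm : MeasurableSet {x : Fin d → ℝ | ∀ j, 0 ≤ x j} := by
    have : {x : Fin d → ℝ | ∀ j, 0 ≤ x j} = Set.Ici 0 := by
      ext x
      simp [Pi.le_def]
    rw [this]
    exact measurableSet_Ici
  rw [gammaConv, ae_map_iff (measurable_mixScales s).aemeasurable hm]
  have h : ∀ᵐ z ∂(Measure.pi fun i => stdGamma (α i)), ∀ i, 0 ≤ z i :=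
    eventually_all.2 fun i =>
      (Measure.tendsto_eval_ae_ae (μ := fun i => stdGamma (α i)) (i := i)).eventually
        (ae_nonneg_stdGamma (α i))
  filter_upwards [h] with z hz j
  exact Finset.sum_nonneg fun i _ => mul_nonneg (s i j).2 (hz i)

/-- The Laplace exponent of a gamma convolution. -/
def laplaceExponent {d n : ℕ} (α : Fin n → ℝ≥0) (s : Matrix (Fin n) (Fin d) ℝ≥0)
    (t : Fin d → ℝ) : ℝ :=
  ∑ i, (α i : ℝ) * Real.log (1 + scaleVec s i ⬝ᵥ t)

lemma scaleVec_dotProduct_nonneg {d n : ℕ} (s : Matrix (Fin n) (Fin d) ℝ≥0) (i : Fin n)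
    {t : Fin d → ℝ} (ht : ∀ j, 0 ≤ t j) : 0 ≤ scaleVec s i ⬝ᵥ t :=
  Finset.sum_nonneg fun j _ => mul_nonneg (s i j).2 (ht j)

lemma integral_exp_neg_dotProduct_gammaConv {d n : ℕ} (α : Fin n → ℝ≥0)
    (s : Matrix (Fin n) (Fin d) ℝ≥0) {t : Fin d → ℝ} (ht : ∀ j, 0 ≤ t j) :
    ∫ x, Real.exp (-(t ⬝ᵥ x)) ∂(gammaConv α s) = Real.exp (-laplaceExponent α s t) := by
  have hs : ∀ i, ∑ j, (s i j : ℝ) * (-t) j = -(scaleVec s i ⬝ᵥ t) := by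
    intro i
    simp [scaleVec, dotProduct]
  obtain ⟨hint, hlog⟩ := cgf_gammaConv α s (-t) fun i => by
    rw [hs]
    linarith [scaleVec_dotProduct_nonneg s i ht]
  have he : ∀ x : Fin d → ℝ, ∑ j, (-t) j * x j = -(t ⬝ᵥ x) := by
    intro x
    simp [dotProduct]
  simp only [he, hs, sub_neg_eq_add] at hint hlog
  rw [← Real.exp_log (integral_exp_pos hint), hlog, laplaceExponent, ← Finset.sum_neg_distrib]
  congr 1
  exact Finset.sum_congr rfl fun i _ => by ring

/-- Convergence of the Laguerre coefficients of gamma convolutions implies convergence of the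
Laplace exponents on `(0, 2)^d`. -/
theorem tendsto_laplaceExponent {d n : ℕ} {β : ℕ → Fin n → ℝ≥0}
    {r : ℕ → Matrix (Fin n) (Fin d) ℝ≥0} {α : Fin n → ℝ≥0} {s : Matrix (Fin n) (Fin d) ℝ≥0}
    (h : ∀ k, Tendsto (fun p => laguerreCoeff k (β p) (r p)) atTop (nhds (laguerreCoeff k α s)))
    {t : Fin d → ℝ} (ht : ∀ j, t j ∈ Set.Ioo 0 2) :
    Tendsto (fun p => laplaceExponent (β p) (r p) t) atTop (nhds (laplaceExponent α s t)) := by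
  have h1 := tendsto_laplace_of_tendsto_laguerre (fun p => ae_nonneg_gammaConv (β p) (r p))
    (ae_nonneg_gammaConv α s) h ht
  have ht0 : ∀ j, 0 ≤ t j := fun j => (ht j).1.le
  simp only [integral_exp_neg_dotProduct_gammaConv _ _ ht0] at h1
  have h2 := (((Real.continuousAt_log (Real.exp_pos _).ne').tendsto).comp h1).neg
  simpa [Function.comp_def] using h2

/-! ### Uniqueness of Laplace transforms -/

/-- The weight `e^{-∑ x j}`. -/
def expWeight {d : ℕ} (x : Fin d → ℝ) : ℝ≥0∞ := ENNReal.ofReal (Real.exp (-((1 : Fin d → ℝ) ⬝ᵥ x)))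

lemma measurable_expWeight {d : ℕ} : Measurable (expWeight (d := d)) := by
  unfold expWeight dotProduct
  fun_prop

lemma isFiniteMeasure_withDensity_expWeight {d : ℕ} {μ : Measure (Fin d → ℝ)} [IsFiniteMeasure μ]
    (hμ : ∀ᵐ x ∂μ, ∀ j, 0 ≤ x j) : IsFiniteMeasure (μ.withDensity expWeight) := by
  refine isFiniteMeasure_withDensity (lt_of_le_of_lt (lintegral_mono_ae (g := fun _ => 1) ?_)
    (by simp)).ne
  filter_upwards [hμ] with x hx
  refine ENNReal.ofReal_le_one.2 (Real.exp_le_one_iff.2 (neg_nonpos.2 ?_))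
  exact Finset.sum_nonneg fun j _ => mul_nonneg zero_le_one (hx j)

lemma dual_apply_eq {d : ℕ} (L : StrongDual ℝ (Fin d → ℝ)) (x : Fin d → ℝ) :
    L x = (fun j => L (Pi.single j 1)) ⬝ᵥ x := by
  conv_lhs => rw [← Finset.univ_sum_single x]
  rw [map_sum]
  refine Finset.sum_congr rfl fun j _ => ?_
  have : Pi.single j (x j) = x j • (Pi.single j 1 : Fin d → ℝ) := by
    rw [← Pi.single_smul, smul_eq_mul, mul_one]
  rw [this, map_smul, smul_eq_mul, mul_comm]

lemma integrable_exp_dual {d : ℕ} {μ : Measure (Fin d → ℝ)} [IsFiniteMeasure μ]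
    (hμ : ∀ᵐ x ∂μ, ∀ j, 0 ≤ x j) (L : StrongDual ℝ (Fin d → ℝ)) {c : ℝ}
    (hc : ∀ j, |c * L (Pi.single j 1)| < 1) :
    Integrable (fun x => Real.exp (c * L x)) (μ.withDensity expWeight) ∧
      ∫ x, Real.exp (c * L x) ∂(μ.withDensity expWeight) =
        ∫ x, Real.exp (-((1 - c • fun j => L (Pi.single j 1)) ⬝ᵥ x)) ∂μ := by
  have hfin : ∀ᵐ x ∂μ, expWeight x < ∞ := ae_of_all _ fun x => ENNReal.ofReal_lt_top
  have he : ∀ x : Fin d → ℝ, (expWeight x).toReal • Real.exp (c * L x) =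
      Real.exp (-((1 - c • fun j => L (Pi.single j 1)) ⬝ᵥ x)) := by
    intro x
    rw [expWeight, ENNReal.toReal_ofReal (Real.exp_pos _).le, smul_eq_mul, ← Real.exp_add,
      dual_apply_eq L x, sub_dotProduct, smul_dotProduct, smul_eq_mul]
    congr 1
    ring
  rw [integrable_withDensity_iff_integrable_smul' measurable_expWeight hfin,
    integral_withDensity_eq_integral_toReal_smul measurable_expWeight hfin]
  simp only [he, and_true]
  have hm : Measurable fun x : Fin d → ℝ =>
      Real.exp (-((1 - c • fun j => L (Pi.single j 1)) ⬝ᵥ x)) := by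
    unfold dotProduct
    fun_prop
  refine (integrable_const (1 : ℝ)).mono' hm.aestronglyMeasurable ?_
  filter_upwards [hμ] with x hx
  rw [Real.norm_eq_abs, Real.abs_exp]
  refine Real.exp_le_one_iff.2 (neg_nonpos.2 (Finset.sum_nonneg fun j _ => mul_nonneg ?_ (hx j)))
  have := (abs_lt.1 (hc j)).2
  simp only [Pi.sub_apply, Pi.one_apply, Pi.smul_apply, smul_eq_mul]
  linarith

/-- Finite measures on `[0, ∞)^d` are determined by their Laplace transforms on `(0, 2)^d`. -/
theorem ext_of_laplace {d : ℕ} {μ ν : Measure (Fin d → ℝ)} [IsFiniteMeasure μ] [IsFiniteMeasure ν]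
    (hμ : ∀ᵐ x ∂μ, ∀ j, 0 ≤ x j) (hν : ∀ᵐ x ∂ν, ∀ j, 0 ≤ x j)
    (h : ∀ t : Fin d → ℝ, (∀ j, t j ∈ Set.Ioo 0 2) →
      ∫ x, Real.exp (-(t ⬝ᵥ x)) ∂μ = ∫ x, Real.exp (-(t ⬝ᵥ x)) ∂ν) : μ = ν := by
  have := isFiniteMeasure_withDensity_expWeight hμ
  have := isFiniteMeasure_withDensity_expWeight hν
  -- After tilting by `e^{-∑ x j}`, exponential moments exist near `0`: along `L` they are Laplace
  -- transforms at points near `(1, …, 1)`. The complex moment generating functions are analytic on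
  -- a vertical strip and agree on a real interval, hence also at `I`, which gives the
  -- characteristic functions.
  have hext : μ.withDensity expWeight = ν.withDensity expWeight := by
    refine Measure.ext_of_charFunDual (funext fun L => ?_)
    set δ : ℝ := (1 + ∑ j, |L (Pi.single j 1)|)⁻¹ with hδdef
    have hsum : 0 ≤ ∑ j, |L (Pi.single j 1)| := Finset.sum_nonneg fun j _ => abs_nonneg _
    have hδ : 0 < δ := by positivity
    have hsmall : ∀ c ∈ Set.Ioo (-δ) δ, ∀ j, |c * L (Pi.single j 1)| < 1 := by
      intro c hc j
      have h1 : |c| < δ := abs_lt.2 hc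
      have h2 : |L (Pi.single j 1)| ≤ ∑ j, |L (Pi.single j 1)| :=
        Finset.single_le_sum (f := fun j => |L (Pi.single j 1)|) (fun j _ => abs_nonneg _)
          (Finset.mem_univ j)
      rw [abs_mul]
      calc |c| * |L (Pi.single j 1)| ≤ |c| * (1 + ∑ j, |L (Pi.single j 1)|) := by
            gcongr
            linarith
        _ < δ * (1 + ∑ j, |L (Pi.single j 1)|) := by gcongr
        _ = 1 := inv_mul_cancel₀ (by positivity)
    have hsub : ∀ {ρ : Measure (Fin d → ℝ)} [IsFiniteMeasure ρ], (∀ᵐ x ∂ρ, ∀ j, 0 ≤ x j) →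
        Set.Ioo (-δ) δ ⊆ interior (integrableExpSet L (ρ.withDensity expWeight)) := fun hρ =>
      interior_maximal (fun c hc => (integrable_exp_dual hρ L (hsmall c hc)).1) isOpen_Ioo
    have hmgf : ∀ c ∈ Set.Ioo (-δ) δ, complexMGF L (μ.withDensity expWeight) c =
        complexMGF L (ν.withDensity expWeight) c := by
      intro c hc
      rw [complexMGF_ofReal, complexMGF_ofReal, mgf, mgf,
        (integrable_exp_dual hμ L (hsmall c hc)).2, (integrable_exp_dual hν L (hsmall c hc)).2]
      rw [h _ fun j => ?_]
      have := abs_lt.1 (hsmall c hc j)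
      simp only [Pi.sub_apply, Pi.one_apply, Pi.smul_apply, smul_eq_mul, Set.mem_Ioo]
      constructor <;> linarith [this.1, this.2]
    have heq := eqOn_strip_of_eventuallyEq (convex_Ioo (-δ) δ)
      (fun z hz => analyticAt_complexMGF (hsub hμ hz))
      (fun z hz => analyticAt_complexMGF (hsub hν hz)) (t := 0) ⟨neg_lt_zero.2 hδ, hδ⟩
      (nhdsWithin_le_nhds (Filter.mem_of_superset (Ioo_mem_nhds (neg_lt_zero.2 hδ) hδ) hmgf))
      (show Complex.I ∈ {z : ℂ | z.re ∈ Set.Ioo (-δ) δ} by simp [hδ])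
    simp only [complexMGF] at heq
    rw [charFunDual_apply, charFunDual_apply]
    simpa only [mul_comm Complex.I] using heq
  have hne : ∀ x : Fin d → ℝ, expWeight x ≠ 0 := fun x => (ENNReal.ofReal_pos.2 (Real.exp_pos _)).ne'
  have hfin : ∀ x : Fin d → ℝ, expWeight x ≠ ∞ := fun x => ENNReal.ofReal_ne_top
  rw [← withDensity_inv_same measurable_expWeight (μ := μ) (ae_of_all _ hne) (ae_of_all _ hfin),
    ← withDensity_inv_same measurable_expWeight (μ := ν) (ae_of_all _ hne) (ae_of_all _ hfin), hext]

/-- Gamma convolutions are determined by their Laplace exponents on `(0, 2)^d`. -/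
theorem gammaConv_eq_of_laplaceExponent_eq {d n : ℕ} {α β : Fin n → ℝ≥0}
    {s r : Matrix (Fin n) (Fin d) ℝ≥0}
    (h : ∀ t : Fin d → ℝ, (∀ j, t j ∈ Set.Ioo 0 2) →
      laplaceExponent α s t = laplaceExponent β r t) : gammaConv α s = gammaConv β r := by
  refine ext_of_laplace (ae_nonneg_gammaConv α s) (ae_nonneg_gammaConv β r) fun t ht => ?_
  have ht0 : ∀ j, 0 ≤ t j := fun j => (ht j).1.le
  rw [integral_exp_neg_dotProduct_gammaConv α s ht0, integral_exp_neg_dotProduct_gammaConv β r ht0,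
    h t ht]

/-! ### Compactness of the parameters -/

/-- The number `1 + l * x` lies between `1 + x` and `l * (1 + x)`. -/
lemma abs_log_one_add_mul_sub_le {l x : ℝ} (hl : 0 < l) (hx : 0 ≤ x) :
    |Real.log (1 + l * x) - Real.log (1 + x)| ≤ |Real.log l| := by
  have hlx : 0 ≤ l * x := by positivity
  rcases le_total l 1 with h | h
  · have h1 : l * x ≤ x := mul_le_of_le_one_left hx h
    have h2 : Real.log (1 + l * x) ≤ Real.log (1 + x) := Real.log_le_log (by linarith) (by linarith)
    have h3 : Real.log (l * (1 + x)) ≤ Real.log (1 + l * x) :=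
      Real.log_le_log (by positivity) (by linarith)
    rw [Real.log_mul hl.ne' (by linarith)] at h3
    rw [abs_of_nonpos (by linarith), abs_of_nonpos (Real.log_nonpos hl.le h)]
    linarith
  · have h1 : x ≤ l * x := le_mul_of_one_le_left hx h
    have h2 : Real.log (1 + x) ≤ Real.log (1 + l * x) := Real.log_le_log (by linarith) (by linarith)
    have h3 : Real.log (1 + l * x) ≤ Real.log (l * (1 + x)) :=
      Real.log_le_log (by positivity) (by linarith)
    rw [Real.log_mul hl.ne' (by linarith)] at h3
    rw [abs_of_nonneg (by linarith), abs_of_nonneg (Real.log_nonneg h)]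
    linarith

lemma div_le_log_one_add {y : ℝ} (hy : 0 ≤ y) : y / (1 + y) ≤ Real.log (1 + y) := by
  have h := Real.one_sub_inv_le_log_of_pos (x := 1 + y) (by linarith)
  have h1 : y / (1 + y) = 1 - (1 + y)⁻¹ := by
    have : 1 + y ≠ 0 := by linarith
    field_simp
    ring
  rwa [h1]

lemma log_one_add_le_self {y : ℝ} (hy : 0 ≤ y) : Real.log (1 + y) ≤ y := by
  have := Real.log_le_sub_one_of_pos (x := 1 + y) (by linarith)
  linarith

/-- The drift regime: `log (1 + x)` behaves like `x`, so `l` factors out. Since `b` may be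
unbounded, the comparison is made with the multiplicative bounds `x / (1 + x) ≤ log (1 + x) ≤ x`. -/
lemma tendsto_mul_log_of_tendsto_zero {b x : ℕ → ℝ} {u l : ℝ} (hb : ∀ p, 0 ≤ b p)
    (hx : ∀ p, 0 ≤ x p) (hl : 0 < l)
    (hu : Tendsto (fun p => b p * Real.log (1 + x p)) atTop (nhds u))
    (hx0 : Tendsto x atTop (nhds 0)) :
    Tendsto (fun p => b p * Real.log (1 + l * x p)) atTop (nhds (l * u)) := by
  have h1 : Tendsto (fun p => l / (1 + l * x p) * (b p * Real.log (1 + x p))) atTop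
      (nhds (l * u)) := by
    have h : Tendsto (fun p => l / (1 + l * x p)) atTop (nhds (l / (1 + l * 0))) :=
      tendsto_const_nhds.div ((hx0.const_mul l).const_add 1) (by simp)
    simpa using h.mul hu
  have h2 : Tendsto (fun p => l * (1 + x p) * (b p * Real.log (1 + x p))) atTop
      (nhds (l * u)) := by
    simpa using ((hx0.const_add 1).const_mul l).mul hu
  refine tendsto_of_tendsto_of_tendsto_of_le_of_le h1 h2 (fun p => ?_) (fun p => ?_)
  · have hlx : 0 ≤ l * x p := mul_nonneg hl.le (hx p)
    calc l / (1 + l * x p) * (b p * Real.log (1 + x p)) ≤ l / (1 + l * x p) * (b p * x p) := by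
          gcongr
          · exact hb p
          · exact log_one_add_le_self (hx p)
      _ = b p * (l * x p / (1 + l * x p)) := by ring
      _ ≤ b p * Real.log (1 + l * x p) :=
          mul_le_mul_of_nonneg_left (div_le_log_one_add hlx) (hb p)
  · have hlx : 0 ≤ l * x p := mul_nonneg hl.le (hx p)
    have hx1 : 0 < 1 + x p := by linarith [hx p]
    calc b p * Real.log (1 + l * x p) ≤ b p * (l * x p) :=
          mul_le_mul_of_nonneg_left (log_one_add_le_self hlx) (hb p)
      _ = l * (1 + x p) * (b p * (x p / (1 + x p))) := by field_simp
      _ ≤ l * (1 + x p) * (b p * Real.log (1 + x p)) := by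
          gcongr
          · exact hb p
          · exact div_le_log_one_add (hx p)

/-- The escape regime: `b` tends to `0`, and rescaling `x` changes the logarithm by a bounded
amount, so the limit does not depend on `l`. -/
lemma tendsto_mul_log_of_tendsto_atTop {b x : ℕ → ℝ} {u l : ℝ}
    (hx : ∀ p, 0 ≤ x p) (hl : 0 < l)
    (hu : Tendsto (fun p => b p * Real.log (1 + x p)) atTop (nhds u))
    (hx0 : Tendsto x atTop atTop) :
    Tendsto (fun p => b p * Real.log (1 + l * x p)) atTop (nhds u) := by
  have hlog : Tendsto (fun p => Real.log (1 + x p)) atTop atTop :=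
    Real.tendsto_log_atTop.comp (tendsto_atTop_add_const_left _ 1 hx0)
  have hb : Tendsto b atTop (nhds 0) := by
    refine (hu.div_atTop hlog).congr' ?_
    filter_upwards [hlog.eventually_gt_atTop 0] with p hp
    rw [mul_div_cancel_right₀ _ hp.ne']
  have h1 : Tendsto (fun p => b p * (Real.log (1 + l * x p) - Real.log (1 + x p))) atTop
      (nhds 0) := by
    refine squeeze_zero_norm (a := fun p => |b p| * |Real.log l|) (fun p => ?_) ?_
    · rw [norm_mul]
      exact mul_le_mul_of_nonneg_left (abs_log_one_add_mul_sub_le hl (hx p)) (abs_nonneg _)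
    · simpa using hb.abs.mul_const _
  have h2 := h1.add hu
  rw [zero_add] at h2
  exact h2.congr fun p => by ring

/-- The possible limits of one gamma component along a sequence of parameters. -/
lemma exists_component_limit {d : ℕ} {b : ℕ → ℝ≥0} {r : ℕ → Fin d → ℝ≥0} {c : Fin d → ℝ≥0∞}
    {u : ℝ} (hr : ∀ j, Tendsto (fun p => (r p j : ℝ≥0∞)) atTop (nhds (c j)))
    (hu : Tendsto (fun p => (b p : ℝ) * Real.log (1 + ∑ j, (r p j : ℝ))) atTop (nhds u)) :
    ∃ (a : ℝ≥0) (σ : Fin d → ℝ≥0) (U V : ℝ), 0 ≤ U ∧ 0 ≤ V ∧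
      (∀ l : ℝ, 0 < l → Tendsto (fun p => (b p : ℝ) * Real.log (1 + l * ∑ j, (r p j : ℝ))) atTop
        (nhds (a * Real.log (1 + l * ∑ j, (σ j : ℝ)) + (l * U + V)))) ∧
      ((Tendsto b atTop (nhds a) ∧ ∀ j, Tendsto (fun p => r p j) atTop (nhds (σ j))) ∨
        (a = 0 ∧ (∀ j, σ j = 0) ∧ u = U + V)) := by
  have hx : ∀ p, 0 ≤ ∑ j, (r p j : ℝ) := fun p => Finset.sum_nonneg fun j _ => (r p j).2
  have hu0 : 0 ≤ u := ge_of_tendsto' hu fun p =>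
    mul_nonneg (b p).2 (Real.log_nonneg (by linarith [hx p]))
  by_cases hfin : ∀ j, c j ≠ ∞
  · have hr' : ∀ j, Tendsto (fun p => r p j) atTop (nhds (c j).toNNReal) := fun j => by
      have := (ENNReal.tendsto_toNNReal (hfin j)).comp (hr j)
      simpa [Function.comp_def] using this
    have hxl : Tendsto (fun p => ∑ j, (r p j : ℝ)) atTop (nhds (∑ j, ((c j).toNNReal : ℝ))) :=
      tendsto_finsetSum _ fun j _ => (NNReal.continuous_coe.tendsto _).comp (hr' j)
    set ξ : ℝ := ∑ j, ((c j).toNNReal : ℝ) with hξ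
    have hξ0 : 0 ≤ ξ := Finset.sum_nonneg fun j _ => NNReal.coe_nonneg _
    -- If the row vanishes in the limit, all of `u` becomes the drift `U`. Otherwise `log (1 + ξ) >
    -- 0`, and dividing by it recovers the limit of the shape.
    rcases hξ0.eq_or_lt with h0 | hpos
    · rw [← h0] at hxl
      refine ⟨0, 0, u, 0, hu0, le_rfl, fun l hl => ?_, Or.inr ⟨rfl, fun _ => rfl, by simp⟩⟩
      simpa using tendsto_mul_log_of_tendsto_zero (fun p => (b p).2) hx hl hu hxl
    · have hlogpos : 0 < Real.log (1 + ξ) := Real.log_pos (by linarith)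
      have hlog : ∀ l : ℝ, 0 < l → Tendsto (fun p => Real.log (1 + l * ∑ j, (r p j : ℝ))) atTop
          (nhds (Real.log (1 + l * ξ))) := fun l hl =>
        ((hxl.const_mul l).const_add 1).log (by positivity)
      have hlog1 := hlog 1 one_pos
      simp only [one_mul] at hlog1
      have hb : Tendsto (fun p => (b p : ℝ)) atTop (nhds (u / Real.log (1 + ξ))) := by
        refine (hu.div hlog1 hlogpos.ne').congr' ?_
        filter_upwards [hlog1.eventually_const_lt hlogpos] with p hp
        exact mul_div_cancel_right₀ _ hp.ne'
      have hb0 : 0 ≤ u / Real.log (1 + ξ) := div_nonneg hu0 hlogpos.le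
      refine ⟨⟨u / Real.log (1 + ξ), hb0⟩, fun j => (c j).toNNReal, 0, 0, le_rfl, le_rfl,
        fun l hl => ?_, Or.inl ⟨?_, hr'⟩⟩
      · simp only [mul_zero, add_zero]
        exact hb.mul (hlog l hl)
      · exact NNReal.tendsto_coe.1 hb
  · push Not at hfin
    obtain ⟨j₀, hj₀⟩ := hfin
    have hj : Tendsto (fun p => (r p j₀ : ℝ)) atTop atTop := by
      have := hr j₀
      rw [hj₀, ENNReal.tendsto_coe_nhds_top] at this
      exact NNReal.tendsto_coe_atTop.2 this
    have hxl : Tendsto (fun p => ∑ j, (r p j : ℝ)) atTop atTop :=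
      tendsto_atTop_mono (fun p => Finset.single_le_sum (f := fun j => (r p j : ℝ))
        (fun j _ => (r p j).2) (Finset.mem_univ j₀)) hj
    refine ⟨0, 0, 0, u, le_rfl, hu0, fun l hl => ?_, Or.inr ⟨rfl, fun _ => rfl, by simp⟩⟩
    simpa using tendsto_mul_log_of_tendsto_atTop hx hl hu hxl

lemma tendsto_log_one_add_mul_div (x : ℝ) (hx : 0 ≤ x) :
    Tendsto (fun l : ℝ => Real.log (1 + l * x) / l) atTop (nhds 0) := by
  have h1 : Tendsto (fun l : ℝ => (Real.log l + Real.log (1 + x)) / l) atTop (nhds 0) := by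
    have h2 : Tendsto (fun l : ℝ => Real.log l / l) atTop (nhds 0) := by
      simpa using Real.tendsto_pow_log_div_mul_add_atTop 1 0 1 one_ne_zero
    have h3 : Tendsto (fun l : ℝ => Real.log (1 + x) / l) atTop (nhds 0) :=
      tendsto_const_nhds.div_atTop tendsto_id
    simpa only [add_div, add_zero] using h2.add h3
  refine tendsto_of_tendsto_of_tendsto_of_le_of_le' tendsto_const_nhds h1 ?_ ?_
  · filter_upwards [eventually_ge_atTop 1] with l hl
    have : 0 ≤ l * x := by positivity
    exact div_nonneg (Real.log_nonneg (by linarith)) (by linarith)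
  · filter_upwards [eventually_ge_atTop 1] with l hl
    have hl0 : 0 < l := by linarith
    rw [← Real.log_mul hl0.ne' (by linarith)]
    gcongr
    linarith

lemma tendsto_sum_log_div {ι : Type*} [Fintype ι] (a x : ι → ℝ) (hx : ∀ i, 0 ≤ x i) :
    Tendsto (fun l : ℝ => (∑ i, a i * Real.log (1 + l * x i)) / l) atTop (nhds 0) := by
  have h : Tendsto (fun l : ℝ => ∑ i, a i * (Real.log (1 + l * x i) / l)) atTop
      (nhds (∑ i, a i * 0)) :=
    tendsto_finsetSum _ fun i _ => (tendsto_log_one_add_mul_div (x i) (hx i)).const_mul _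
  simpa only [mul_zero, Finset.sum_const_zero, Finset.sum_div, mul_div_assoc] using h

lemma tendsto_sum_log_nhdsGT {ι : Type*} [Fintype ι] (a x : ι → ℝ) :
    Tendsto (fun l : ℝ => ∑ i, a i * Real.log (1 + l * x i)) (nhdsWithin 0 (Set.Ioi 0))
      (nhds 0) := by
  have h : ContinuousAt (fun l : ℝ => ∑ i, a i * Real.log (1 + l * x i)) 0 := by
    refine tendsto_finsetSum _ fun i _ => Tendsto.const_mul _ ?_
    exact ContinuousAt.log (by fun_prop) (by simp)
  simpa using h.tendsto.mono_left nhdsWithin_le_nhds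

lemma analyticOnNhd_sum_log {ι : Type*} [Fintype ι] (a x : ι → ℝ) (hx : ∀ i, 0 ≤ x i) :
    AnalyticOnNhd ℝ (fun l : ℝ => ∑ i, a i * Real.log (1 + l * x i)) (Set.Ioi 0) := by
  intro l hl
  have hl0 : (0 : ℝ) < l := hl
  refine Finset.analyticAt_fun_sum _ fun i _ => analyticAt_const.mul ?_
  refine AnalyticAt.log (by fun_prop) ?_
  have := hx i
  positivity

/-- By analyticity the identity extends from `(0, 2)` to `(0, ∞)`. The logarithms vanish at `0`,
which kills `V`, and are sublinear at infinity, which kills `U`. -/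
lemma affine_eq_zero_of_sum_log_eq {ι κ : Type*} [Fintype ι] [Fintype κ] {a x : ι → ℝ}
    {b y : κ → ℝ} {U V : ℝ} (hx : ∀ i, 0 ≤ x i) (hy : ∀ i, 0 ≤ y i)
    (h : ∀ l ∈ Set.Ioo (0 : ℝ) 2, ∑ i, a i * Real.log (1 + l * x i) =
      ∑ i, b i * Real.log (1 + l * y i) + (l * U + V)) : U = 0 ∧ V = 0 := by
  have hall : Set.EqOn (fun l : ℝ => ∑ i, a i * Real.log (1 + l * x i))
      (fun l => ∑ i, b i * Real.log (1 + l * y i) + (l * U + V)) (Set.Ioi 0) := by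
    refine (analyticOnNhd_sum_log a x hx).eqOn_of_preconnected_of_eventuallyEq
      ((analyticOnNhd_sum_log b y hy).add ?_) isPreconnected_Ioi
      (z₀ := 1) (Set.mem_Ioi.2 one_pos) ?_
    · intro l _
      fun_prop
    · exact Filter.mem_of_superset (Ioo_mem_nhds one_pos one_lt_two) h
  have hV : V = 0 := by
    have h1 : Tendsto (fun l : ℝ => l * U + V) (nhdsWithin 0 (Set.Ioi 0)) (nhds (0 * U + V)) :=
      (Continuous.tendsto (by fun_prop) 0).mono_left nhdsWithin_le_nhds
    have h2 := ((tendsto_sum_log_nhdsGT a x).sub (tendsto_sum_log_nhdsGT b y)).congr'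
      (f₂ := fun l => l * U + V) (by
        filter_upwards [self_mem_nhdsWithin] with l hl
        have := hall hl
        simp only at this
        linarith)
    simpa using tendsto_nhds_unique h1 h2
  refine ⟨?_, hV⟩
  have h2 := ((tendsto_sum_log_div a x hx).sub (tendsto_sum_log_div b y hy)).congr'
      (f₂ := fun _ => U) (by
        filter_upwards [eventually_gt_atTop 0] with l hl
        have := hall hl
        simp only [hV, add_zero] at this
        rw [← sub_div, this, add_sub_cancel_left, mul_div_cancel_left₀ _ hl.ne'])
  simpa using tendsto_nhds_unique tendsto_const_nhds h2

lemma scaleVec_dotProduct_const {d n : ℕ} (s : Matrix (Fin n) (Fin d) ℝ≥0) (i : Fin n) (l : ℝ) :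
    (scaleVec s i ⬝ᵥ fun _ => l) = l * ∑ j, (s i j : ℝ) := by
  rw [dotProduct.eq_def, Finset.mul_sum]
  exact Finset.sum_congr rfl fun j _ => mul_comm _ _

/-- Convergence of the Laplace exponents implies convergence of the parameters along a
subsequence, to parameters of the same law. -/
theorem exists_paramsConverge {d n : ℕ} {β : ℕ → Fin n → ℝ≥0}
    {r : ℕ → Matrix (Fin n) (Fin d) ℝ≥0} {α : Fin n → ℝ≥0} {s : Matrix (Fin n) (Fin d) ℝ≥0}
    (h : ∀ t : Fin d → ℝ, (∀ j, t j ∈ Set.Ioo 0 2) →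
      Tendsto (fun p => laplaceExponent (β p) (r p) t) atTop (nhds (laplaceExponent α s t))) :
    ∃ (φ : ℕ → ℕ) (α' : Fin n → ℝ≥0) (s' : Matrix (Fin n) (Fin d) ℝ≥0) (good : Set (Fin n)),
      StrictMono φ ∧ ParamsConverge (β ∘ φ) (r ∘ φ) α' s' good ∧
        gammaConv α' s' = gammaConv α s := by
  -- Shapes and scales need not be bounded. Compactness holds instead for the scales in `[0, ∞]` and
  -- for `u p i`, the contribution of component `i` to the exponent at `(1, …, 1)`, whose sum
  -- converges.
  set u : ℕ → Fin n → ℝ := fun p i => (β p i : ℝ) * Real.log (1 + ∑ j, (r p i j : ℝ)) with hu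
  have hx : ∀ p i, 0 ≤ ∑ j, (r p i j : ℝ) := fun p i =>
    Finset.sum_nonneg fun j _ => (r p i j).2
  have hu0 : ∀ p i, 0 ≤ u p i := fun p i =>
    mul_nonneg (β p i).2 (Real.log_nonneg (by linarith [hx p i]))
  have hone := h (fun _ => 1) fun _ => ⟨one_pos, one_lt_two⟩
  have hsum : ∀ p, laplaceExponent (β p) (r p) (fun _ => 1) = ∑ i, u p i := fun p => by
    simp only [laplaceExponent, scaleVec_dotProduct_const, one_mul, hu]
  obtain ⟨C, hC⟩ := hone.bddAbove_range
  have huC : ∀ p i, u p i ≤ C := fun p i =>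
    (Finset.single_le_sum (fun i _ => hu0 p i) (Finset.mem_univ i)).trans
      ((hsum p).symm.le.trans (hC ⟨p, rfl⟩))
  obtain ⟨c, -, φ₁, hφ₁, hc⟩ := (isCompact_univ (X := Fin n → Fin d → ℝ≥0∞)).tendsto_subseq
    (x := fun p i j => (r p i j : ℝ≥0∞)) fun _ => Set.mem_univ _
  obtain ⟨v, -, φ₂, hφ₂, hv⟩ := (isCompact_univ_pi fun _ : Fin n =>
    isCompact_Icc (a := (0 : ℝ)) (b := C)).tendsto_subseq (x := u ∘ φ₁)
      fun p i _ => ⟨hu0 _ i, huC _ i⟩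
  set φ := φ₁ ∘ φ₂ with hφ
  have hφm : StrictMono φ := hφ₁.comp hφ₂
  have hr : ∀ i j, Tendsto (fun p => (r (φ p) i j : ℝ≥0∞)) atTop (nhds (c i j)) := fun i j =>
    (tendsto_pi_nhds.1 (tendsto_pi_nhds.1 (hc.comp hφ₂.tendsto_atTop) i) j)
  have hv' : ∀ i, Tendsto (fun p => u (φ p) i) atTop (nhds (v i)) := tendsto_pi_nhds.1 hv
  choose a σ U V hU hV hlim hcase using fun i => exists_component_limit (hr i) (hv' i)
  -- Comparison of the limits along the diagonal `(l, …, l)` excludes total drift and total escape;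
  -- as all `U i` and `V i` are nonnegative, each vanishes.
  have haff : ∑ i, U i = 0 ∧ ∑ i, V i = 0 := by
    refine affine_eq_zero_of_sum_log_eq (a := fun i => (α i : ℝ)) (x := fun i => ∑ j, (s i j : ℝ))
      (b := fun i => (a i : ℝ)) (y := fun i => ∑ j, (σ i j : ℝ))
      (fun i => Finset.sum_nonneg fun j _ => (s i j).2)
      (fun i => Finset.sum_nonneg fun j _ => (σ i j).2) fun l hl => ?_
    have h1 := (h (fun _ => l) fun _ => hl).comp hφm.tendsto_atTop
    have h2 := tendsto_finsetSum Finset.univ fun i _ => hlim i l hl.1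
    simp only [laplaceExponent, scaleVec_dotProduct_const, Function.comp_def] at h1
    rw [tendsto_nhds_unique h1 h2, Finset.sum_add_distrib, Finset.sum_add_distrib, Finset.mul_sum]
  have hU0 : ∀ i, U i = 0 := fun i =>
    (Finset.sum_eq_zero_iff_of_nonneg fun i _ => hU i).1 haff.1 i (Finset.mem_univ i)
  have hV0 : ∀ i, V i = 0 := fun i =>
    (Finset.sum_eq_zero_iff_of_nonneg fun i _ => hV i).1 haff.2 i (Finset.mem_univ i)
  set good : Set (Fin n) := {i | Tendsto (fun p => β (φ p) i) atTop (nhds (a i)) ∧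
    ∀ j, Tendsto (fun p => r (φ p) i j) atTop (nhds (σ i j))} with hgood
  have hbad : ∀ i ∉ good, a i = 0 ∧ (∀ j, σ i j = 0) ∧ v i = U i + V i := fun i hi =>
    (hcase i).resolve_left hi
  refine ⟨φ, a, σ, good, hφm, ⟨fun i hi => hi.1, fun i hi => hi.2, fun i hi => (hbad i hi).1,
    fun i hi => (hbad i hi).2.1, fun i hi => ?_⟩, ?_⟩
  · have := hv' i
    rwa [(hbad i hi).2.2, hU0, hV0, add_zero] at this
  · refine gammaConv_eq_of_laplaceExponent_eq fun t ht => ?_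
    have ht0 : ∀ j, 0 ≤ t j := fun j => (ht j).1.le
    refine tendsto_nhds_unique (tendsto_finsetSum _ fun i _ => ?_)
      ((h t ht).comp hφm.tendsto_atTop)
    by_cases hi : i ∈ good
    · refine ((NNReal.continuous_coe.tendsto _).comp hi.1).mul (Tendsto.log ?_ ?_)
      · refine Tendsto.const_add _ (tendsto_finsetSum _ fun j _ => Tendsto.mul_const _ ?_)
        exact (NNReal.continuous_coe.tendsto _).comp (hi.2 j)
      · have := scaleVec_dotProduct_nonneg (σ : Matrix (Fin n) (Fin d) ℝ≥0) i ht0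
        positivity
    -- Since every `t j < 2`, the contribution of a negligible component at `t` is at most the one
    -- at `(2, …, 2)`, which tends to `0`.
    · have h2 := hlim i 2 two_pos
      simp only [(hbad i hi).1, hU0, hV0, NNReal.coe_zero, zero_mul, mul_zero, add_zero] at h2 ⊢
      have hnn := fun p => scaleVec_dotProduct_nonneg (r (φ p)) i ht0
      refine squeeze_zero (fun p => mul_nonneg (β (φ p) i).2 (Real.log_nonneg ?_)) (fun p => ?_) h2
      · have := hnn p
        linarith
      · refine mul_le_mul_of_nonneg_left (Real.log_le_log ?_ ?_) (β (φ p) i).2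
        · have := hnn p
          linarith
        · rw [← scaleVec_dotProduct_const]
          refine add_le_add_right (Finset.sum_le_sum fun j _ => ?_) 1
          exact mul_le_mul_of_nonneg_left (ht j).2.le (r (φ p) i j).2

/-! ### Stability of gamma convolutions -/

lemma gammaConvDensity_congr {d n : ℕ} {α β : Fin n → ℝ≥0} {s r : Matrix (Fin n) (Fin d) ℝ≥0}
    (h : gammaConv α s = gammaConv β r) : gammaConvDensity α s = gammaConvDensity β r := by
  funext x
  rw [gammaConvDensity, gammaConvDensity, h]

/-- Gamma convolutions whose Laguerre coefficients up to a large order are close to those of a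
given one with a square integrable density have an `L²`-close density. -/
theorem exists_laguerreCoeff_close {d n : ℕ} {α₀ : Fin n → ℝ≥0}
    {s₀ : Matrix (Fin n) (Fin d) ℝ≥0} (hdens : gammaConv α₀ s₀ ≪ volume)
    (hL2 : MemLp (gammaConvDensity α₀ s₀) 2 volume) {ε : ℝ≥0∞} (hε : 0 < ε) :
    ∃ p : ℕ, ∀ (α : Fin n → ℝ≥0) (s : Matrix (Fin n) (Fin d) ℝ≥0),
      (∀ k ≤ fun _ => p, |laguerreCoeff k α s - laguerreCoeff k α₀ s₀| < 1 / ((p : ℝ) + 1)) →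
        gammaConv α s ≪ volume ∧
          eLpNorm (gammaConvDensity α₀ s₀ - gammaConvDensity α s) 2 volume ^ 2 < ε := by
  -- The same integer `p` governs the order and the tolerance, so counterexamples for every `p` form
  -- a sequence along which each fixed coefficient converges.
  by_contra! hcon
  choose β r hclose hfar using hcon
  have hcoeff : ∀ k, Tendsto (fun p => laguerreCoeff k (β p) (r p)) atTop
      (nhds (laguerreCoeff k α₀ s₀)) := by
    intro k
    rw [tendsto_iff_norm_sub_tendsto_zero]
    refine squeeze_zero' (Eventually.of_forall fun _ => norm_nonneg _) ?_
      tendsto_one_div_add_atTop_nhds_zero_nat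
    filter_upwards [eventually_ge_atTop (∑ j, k j)] with p hp
    refine (hclose p k fun j => ?_).le
    exact (Finset.single_le_sum (fun _ _ => Nat.zero_le _) (Finset.mem_univ j)).trans hp
  -- The limit parameters need not be `α₀, s₀`, but they define the same law, so absolute continuity
  -- and the density carry over.
  obtain ⟨φ, α', s', good, -, hconv, heq⟩ :=
    exists_paramsConverge fun t ht => tendsto_laplaceExponent hcoeff ht
  have hden := gammaConvDensity_congr heq
  rw [← heq] at hdens
  rw [← hden] at hL2
  obtain ⟨h1, h2⟩ := hconv.tendsto_eLpNorm hdens hL2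
  have h3 := ENNReal.Tendsto.pow (n := 2) h2
  rw [zero_pow two_ne_zero] at h3
  obtain ⟨p, hp1, hp2⟩ := (h1.and (h3.eventually_lt_const hε)).exists
  rw [hden] at hp2
  exact (hfar (φ p) hp1).not_gt hp2

/-! ### Consistency -/

lemma ae_tendsto_empLaguerreCoeff {d n : ℕ} {α₀ : Fin n → ℝ≥0} {s₀ : Matrix (Fin n) (Fin d) ℝ≥0}
    {Ω : Type*} [MeasurableSpace Ω] {P : Measure Ω} [IsProbabilityMeasure P]
    {X : ℕ → Ω → Fin d → ℝ} (hX : ∀ i, Measurable (X i))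
    (hindep : iIndepFun X P) (hlaw : ∀ i, P.map (X i) = gammaConv α₀ s₀) (k : Fin d → ℕ) :
    ∀ᵐ ω ∂P, Tendsto (fun N : ℕ => empLaguerreCoeff k fun i : Fin N => X i ω) atTop
      (nhds (laguerreCoeff k α₀ s₀)) := by
  have hm := measurable_laguerre k
  have hint : Integrable (laguerre k ∘ X 0) P := by
    rw [← integrable_map_measure hm.aestronglyMeasurable (hX 0).aemeasurable, hlaw]
    exact integrable_laguerre k _
  have hmean : ∫ ω, (laguerre k ∘ X 0) ω ∂P = laguerreCoeff k α₀ s₀ := by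
    rw [laguerreCoeff, ← hlaw 0, integral_map (hX 0).aemeasurable hm.aestronglyMeasurable]
    rfl
  have hid : ∀ i, IdentDistrib (laguerre k ∘ X i) (laguerre k ∘ X 0) P P := fun i =>
    IdentDistrib.comp ⟨(hX i).aemeasurable, (hX 0).aemeasurable, by rw [hlaw, hlaw]⟩ hm
  have hslln := strong_law_ae_real (fun i => laguerre k ∘ X i) hint
    (fun i j hij => (hindep.indepFun hij).comp hm hm) hid
  rw [hmean] at hslln
  filter_upwards [hslln] with ω hω
  refine hω.congr fun N => ?_
  rw [empLaguerreCoeff, Fin.sum_univ_eq_sum_range (fun i => laguerre k (X i ω)), one_div_mul_eq_div]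
  rfl

lemma tendsto_truncLoss {d n : ℕ} {α₀ : Fin n → ℝ≥0} {s₀ : Matrix (Fin n) (Fin d) ℝ≥0}
    {x : ℕ → Fin d → ℝ} (h : ∀ k, Tendsto (fun N : ℕ => empLaguerreCoeff k fun i : Fin N => x i)
      atTop (nhds (laguerreCoeff k α₀ s₀))) (m : Fin d → ℕ) :
    Tendsto (fun N : ℕ => truncLoss m (fun i : Fin N => x i) α₀ s₀) atTop (nhds 0) := by
  have h1 := tendsto_finsetSum (Finset.Iic m) fun k _ =>
    ((h k).sub_const (laguerreCoeff k α₀ s₀)).pow 2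
  simpa [truncLoss] using h1

lemma abs_empLaguerreCoeff_sub_le {d n N : ℕ} {m k : Fin d → ℕ} (hk : k ≤ m)
    (x : Fin N → Fin d → ℝ) (α : Fin n → ℝ≥0) (s : Matrix (Fin n) (Fin d) ℝ≥0) :
    |empLaguerreCoeff k x - laguerreCoeff k α s| ≤ √(truncLoss m x α s) := by
  refine Real.abs_le_sqrt ?_
  exact Finset.single_le_sum (f := fun k => (empLaguerreCoeff k x - laguerreCoeff k α s) ^ 2)
    (fun _ _ => sq_nonneg _) (Finset.mem_Iic.2 hk)

/-- The parameters `α₀, s₀` are admissible, so both coefficients lie within `√(truncLoss m x α₀ s₀)`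
of the empirical one. -/
lemma abs_laguerreCoeff_sub_le_of_isLossMinimizer {d n N : ℕ} {m k : Fin d → ℕ} (hk : k ≤ m)
    {x : Fin N → Fin d → ℝ} {α₀ α : Fin n → ℝ≥0} {s₀ s : Matrix (Fin n) (Fin d) ℝ≥0}
    (hwb : WellBehaved α₀ s₀) (hmin : IsLossMinimizer m x α s) :
    |laguerreCoeff k α s - laguerreCoeff k α₀ s₀| ≤ 2 * √(truncLoss m x α₀ s₀) := by
  have h1 := abs_empLaguerreCoeff_sub_le hk x α₀ s₀
  have h2 := (abs_empLaguerreCoeff_sub_le hk x α s).trans (Real.sqrt_le_sqrt (hmin.2 α₀ s₀ hwb))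
  rw [abs_sub_comm] at h2
  rw [two_mul]
  exact (abs_sub_le _ _ _).trans (add_le_add h2 h1)

lemma eventually_isLossMinimizer_close {d n : ℕ} {α₀ : Fin n → ℝ≥0}
    {s₀ : Matrix (Fin n) (Fin d) ℝ≥0} (hwb : WellBehaved α₀ s₀)
    (hdens : gammaConv α₀ s₀ ≪ volume) (hL2 : MemLp (gammaConvDensity α₀ s₀) 2 volume)
    {x : ℕ → Fin d → ℝ} (hx : ∀ k, Tendsto (fun N : ℕ => empLaguerreCoeff k fun i : Fin N => x i)
      atTop (nhds (laguerreCoeff k α₀ s₀))) {ε : ℝ≥0∞} (hε : 0 < ε) :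
    ∀ᶠ m : Fin d → ℕ in atTop, ∀ᶠ N : ℕ in atTop,
      ∀ (α : Fin n → ℝ≥0) (s : Matrix (Fin n) (Fin d) ℝ≥0),
        IsLossMinimizer m (fun i : Fin N => x i) α s →
          gammaConv α s ≪ volume ∧
            eLpNorm (gammaConvDensity α₀ s₀ - gammaConvDensity α s) 2 volume ^ 2 < ε := by
  obtain ⟨p, hp⟩ := exists_laguerreCoeff_close hdens hL2 hε
  have hδ : (0 : ℝ) < 1 / (p + 1) := by positivity
  -- Only the coefficients of order at most `(p, …, p)` matter, so any `m` above this works.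
  refine (eventually_ge_atTop fun _ => p).mono fun m hm => ?_
  have hloss := ((tendsto_truncLoss hx m).sqrt).const_mul 2
  rw [Real.sqrt_zero, mul_zero] at hloss
  refine (hloss.eventually_lt_const hδ).mono fun N hN α s hmin => ?_
  exact hp α s fun k hk =>
    (abs_laguerreCoeff_sub_le_of_isLossMinimizer (hk.trans hm) hwb hmin).trans_lt hN

end

theorem mainTheorem2 {d n : ℕ} (hd : 0 < d)
    (α₀ : Fin n → ℝ≥0) (s₀ : Matrix (Fin n) (Fin d) ℝ≥0)
    (hwb : WellBehaved α₀ s₀)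
    (hdens : gammaConv α₀ s₀ ≪ volume)
    (hL2 : MemLp (gammaConvDensity α₀ s₀) 2 volume)
    {Ω : Type*} [MeasurableSpace Ω] (P : Measure Ω) [IsProbabilityMeasure P]
    (X : ℕ → Ω → Fin d → ℝ) (hX : ∀ i, Measurable (X i))
    (hindep : iIndepFun X P) (hlaw : ∀ i, P.map (X i) = gammaConv α₀ s₀) :
    ∀ᵐ ω ∂P, ∀ ε : ℝ≥0∞, 0 < ε →
      ∀ᶠ m : Fin d → ℕ in atTop, ∀ᶠ N : ℕ in atTop,
        ∀ (α : Fin n → ℝ≥0) (s : Matrix (Fin n) (Fin d) ℝ≥0),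
          IsLossMinimizer m (fun i : Fin N => X i ω) α s →
            gammaConv α s ≪ volume ∧
              eLpNorm (gammaConvDensity α₀ s₀ - gammaConvDensity α s) 2 volume ^ 2 < ε := by
  -- There are countably many multi-indices, so a single null set, independent of `ε`, `m` and `N`,
  -- is discarded.
  filter_upwards [ae_all_iff.2 fun k => ae_tendsto_empLaguerreCoeff hX hindep hlaw k] with ω hω ε hε
  exact eventually_isLossMinimizer_close (x := fun i => X i ω) hwb hdens hL2 hω hε
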